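/- Let $\rho$ be a probability measure on a measurable space $\mathcal Z$, let $\Omega\subseteq\mathbb R^d$ be nonempty, closed and convex, and let $f:\mathbb R^d\times\mathcal Z\to\mathbb R$ be a loss such that $z\mapsto f(w;z)$ is measurable and $\rho$-integrable for every $w$, and such that for every $z$ the function $w\mapsto f(w;z)$ is nonnegative, convex and $L$-smooth on $\mathbb R^d$ (differentiable with $L$-Lipschitz gradient), where $L>0$. Put $F(w)=\mathbb E_{z\sim\rho}[f(w;z)]$ and let $w^*\in\arg\min_{w\in\Omega}F(w)$. Let $S=(z_1,\dots,z_n)$, $n\ge 1$, be an i.i.d. sample from $\rho$. Projected SGD starts at $w_1=0$ and iterates $$w_{t+1}=\Pi_\Omega\big(w_t-\eta_t\nabla f(w_t;z_{i_t})\big),$$ where $\Pi_\Omega$ is the Euclidean projection on $\Omega$, $\nabla$ is the gradient in $w$, and $i_1,i_2,\dots$ are i.i.d. uniform on $\{1,\dots,n\}$, independent of $S$. Let $\bar w_T=\big(\sum_{t=1}^T\eta_tw_t\big)/\sum_{t=1}^T\eta_t$, and let $\mathbb E_{S,A}$ denote the expectation over $S$ and over the indices. Write $T\asymp n$ if $aT\le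 n\le bT$ with constants $a,b>0$. (a) If $\eta_t=c/\sqrt T\le 1/(2L)$ for all $t$, with a constant $c>0$, and $T\asymp n$, then $F(\bar w_T)$ is integrable and $$\mathbb E_{S,A}[F(\bar w_T)]-F(w^*)=O\Big(\frac{F(w^*)+1}{\sqrt n}\Big),$$ where the constant in $O(\cdot)$ depends only on $L$, $c$, $a$, $b$ and an upper bound $R$ on $\|w^*\|_2$. (b) If $\eta_t=\eta_1$ for all $t$, with a constant $0<\eta_1\le 1/(2L)$, if $F(w^*)=0$ and $T\asymp n$, then $F(\bar w_T)$ is integrable and $$\mathbb E_{S,A}[F(\bar w_T)]-F(w^*)=O(1/n),$$ where the constant in $O(\cdot)$ depends only on $L$, $\eta_1$, $a$, $b$ and an upper bound $R$ on $\|w^*\|_2$. -/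

import Mathlib

open MeasureTheory ProbabilityTheory

noncomputable section

/-- The parameter space `ℝ^d` with its Euclidean norm. -/
abbrev Param (d : ℕ) : Type := EuclideanSpace ℝ (Fin d)

/-- The loss `f(w; z)` is, for every `z`, a nonnegative, convex and `L`-smooth function of
`w ∈ ℝ^d`; `L`-smooth means differentiable with an `L`-Lipschitz gradient. -/
structure IsSmoothConvexLoss {d : ℕ} {Z : Type*} (L : ℝ) (f : Param d → Z → ℝ) : Prop where
  nonneg : ∀ w z, 0 ≤ f w z
  convex : ∀ z, ConvexOn ℝ Set.univ (fun w => f w z)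
  differentiable : ∀ z, Differentiable ℝ (fun w => f w z)
  smooth : ∀ z w w', ‖gradient (fun u => f u z) w - gradient (fun u => f u z) w'‖ ≤ L * ‖w - w'‖

/-- The population risk `F(w) = 𝔼_z f(w; z)`. -/
def popRisk {d : ℕ} {Z : Type*} [MeasurableSpace Z] (ρ : Measure Z) (f : Param d → Z → ℝ)
    (w : Param d) : ℝ :=
  ∫ z, f w z ∂ρ

/-- The Euclidean projection of `x` on `Ω`: the point of `Ω` nearest to `x`
(it exists and is unique when `Ω` is nonempty, closed and convex). -/
def projOn {d : ℕ} (Ω : Set (Param d)) (x : Param d) : Param d :=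
  Classical.epsilon fun y => y ∈ Ω ∧ dist x y = Metric.infDist x Ω

/-- For `Ω` nonempty, closed and convex, `projOn Ω x` is the unique nearest point of `Ω`. -/
theorem projOn_spec {d : ℕ} {Ω : Set (Param d)} (hne : Ω.Nonempty) (hcl : IsClosed Ω)
    (hcv : Convex ℝ Ω) (x : Param d) :
    (projOn Ω x ∈ Ω ∧ dist x (projOn Ω x) = Metric.infDist x Ω) ∧
      ∀ y ∈ Ω, dist x y = Metric.infDist x Ω → y = projOn Ω x := by
  have hex : ∃ y, y ∈ Ω ∧ dist x y = Metric.infDist x Ω := by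
    obtain ⟨y, hy, h⟩ := hcl.exists_infDist_eq_dist hne x
    exact ⟨y, hy, h.symm⟩
  have hp : projOn Ω x ∈ Ω ∧ dist x (projOn Ω x) = Metric.infDist x Ω :=
    Classical.epsilon_spec hex
  have key : ∀ y ∈ Ω, dist x y = Metric.infDist x Ω → ∀ u ∈ Ω, inner ℝ (x - y) (u - y) ≤ 0 := by
    intro y hy hd
    refine (norm_eq_iInf_iff_real_inner_le_zero hcv hy).1 ?_
    rw [← dist_eq_norm, hd, Metric.infDist_eq_iInf]
    simp only [dist_eq_norm]
  refine ⟨hp, fun y hy hd => ?_⟩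
  have h1 := key y hy hd _ hp.1
  have h2 := key _ hp.1 hp.2 y hy
  set q := projOn Ω x
  have h3 : inner ℝ (y - q) (y - q) ≤ (0 : ℝ) := by
    have e : inner ℝ (y - q) (y - q) = inner ℝ (x - y) (q - y) + inner ℝ (x - q) (y - q) := by
      rw [← neg_sub y q, inner_neg_right, ← sub_eq_neg_add, ← inner_sub_left]
      congr 1
      abel
    linarith
  exact sub_eq_zero.1 (real_inner_self_nonpos.1 h3)

/-- The iterates of projected SGD on the sample `S = (z_1, …, z_n)` along the drawn indices `i`.
Everything is indexed from `0`: `sgd Ω f η S i t` is the `(t+1)`-st iterate, so that the value at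
`0` is the initial point `w_1 = 0`, and `η t`, `i t` are the `(t+1)`-st step size and index. -/
def sgd {d n : ℕ} {Z : Type*} (Ω : Set (Param d)) (f : Param d → Z → ℝ) (η : ℕ → ℝ)
    (S : Fin n → Z) (i : ℕ → Fin n) : ℕ → Param d
  | 0 => 0
  | t + 1 =>
      projOn Ω (sgd Ω f η S i t - η t • gradient (fun u => f u (S (i t))) (sgd Ω f η S i t))

/-- The weighted average `(∑_{t ≤ T} η_t w_t) / ∑_{t ≤ T} η_t` of the first `T` iterates. -/
def sgdAverage {d n : ℕ} {Z : Type*} (Ω : Set (Param d)) (f : Param d → Z → ℝ) (η : ℕ → ℝ)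
    (S : Fin n → Z) (i : ℕ → Fin n) (T : ℕ) : Param d :=
  (∑ t ∈ Finset.range T, η t)⁻¹ • ∑ t ∈ Finset.range T, η t • sgd Ω f η S i t

/-- The joint law of the sample and of the drawn indices: `z_1, …, z_n` are i.i.d. with law `ρ`,
the indices are i.i.d. uniform on the `n` sample positions, and the two are independent. -/
def sampleIndexLaw {Z : Type*} [MeasurableSpace Z] (ρ : Measure Z) (n : ℕ) [NeZero n] :
    Measure ((Fin n → Z) × (ℕ → Fin n)) :=
  (Measure.pi fun _ : Fin n => ρ).prod
    (Measure.infinitePi fun _ : ℕ => (PMF.uniformOfFintype (Fin n)).toMeasure)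

end

/-!
A nonnegative `L`-smooth function bounds its own gradient, `‖∇g‖² ≤ 2Lg`, and hence satisfies
`g u ≤ (1 + L/γ) g v + (L + γ)/2 ‖u - v‖²`. Exchange `z_k` with an independent copy: in
expectation, the population risk of the averaged iterate on `S` is its loss at `z_k` when it is
trained on the sample with `z_k` replaced. The inequality compares this with the loss at `z_k` of
the iterates trained on `S`, at the cost of the squared distance between the two trajectories.
Gradient steps of smooth convex functions are nonexpansive, so the trajectories diverge only at the
few steps that draw `k`, and there by at most the losses met along the way. The regret inequality
of projected SGD bounds these losses by the loss of `w^*`, which gives the upper bound with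
`γ = √n`, respectively `γ = 1`.

The averaged iterate need not lie in `Ω`, because `w_1 = 0` need not, so its population risk may be
smaller than `F(w^*)`. Replacing `w_1` by `w^*` moves the average into `Ω` by a shift of
`(η_1 / ∑ η_t) w^*` only, and the same smoothness inequality bounds the resulting loss.
-/

open scoped Gradient InnerProductSpace

section Smooth

variable {E : Type*} [NormedAddCommGroup E] [InnerProductSpace ℝ E] [CompleteSpace E]
  {g h : E → ℝ} {L η : ℝ}

/-- `g` is `L`-smooth: differentiable with an `L`-Lipschitz gradient. As in `IsSmoothConvexLoss`,
the constant is a real number. -/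
structure IsSmoothWith (L : ℝ) (g : E → ℝ) : Prop where
  differentiable : Differentiable ℝ g
  norm_gradient_sub_le : ∀ x y, ‖∇ g x - ∇ g y‖ ≤ L * ‖x - y‖

theorem hasDerivAt_comp_line {x v : E} {s : ℝ} (hg : DifferentiableAt ℝ g (x + s • v)) :
    HasDerivAt (fun s : ℝ => g (x + s • v)) ⟪∇ g (x + s • v), v⟫_ℝ s := by
  have hline : HasDerivAt (fun s : ℝ => x + s • v) v s := by
    simpa using ((hasDerivAt_id s).smul_const v).const_add x
  rw [inner_gradient_left]
  exact hg.hasFDerivAt.comp_hasDerivAt s hline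

theorem add_inner_gradient_le_of_convexOn (hc : ConvexOn ℝ Set.univ g) {x : E}
    (hg : DifferentiableAt ℝ g x) (y : E) : g x + ⟪∇ g x, y - x⟫_ℝ ≤ g y := by
  have hconv : ConvexOn ℝ Set.univ fun s : ℝ => g (x + s • (y - x)) :=
    (hc.comp_affineMap (AffineMap.lineMap x y)).congr fun s _ => by
      simp [AffineMap.lineMap_apply, add_comm]
  have hderiv := hasDerivAt_comp_line (s := 0) (v := y - x) (by simpa using hg)
  have hslope := hconv.le_slope_of_hasDerivAt (Set.mem_univ 0) (Set.mem_univ 1) one_pos hderiv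
  simp only [slope_def_field, zero_smul, add_zero, one_smul, add_sub_cancel, sub_zero,
    div_one] at hslope
  linarith

namespace IsSmoothWith

theorem continuous_gradient (hg : IsSmoothWith L g) : Continuous (∇ g) :=
  (LipschitzWith.of_dist_le'
    (by simpa only [dist_eq_norm] using hg.norm_gradient_sub_le)).continuous

theorem le_add_inner_gradient (hg : IsSmoothWith L g) (x y : E) :
    g y ≤ g x + ⟪∇ g x, y - x⟫_ℝ + L / 2 * ‖y - x‖ ^ 2 := by
  set v := y - x with hv
  let gap : ℝ → ℝ := fun s => g (x + s • v) - s * ⟪∇ g x, v⟫_ℝ - L / 2 * s ^ 2 * ‖v‖ ^ 2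
  have hderiv (s : ℝ) :
      HasDerivAt gap (⟪∇ g (x + s • v) - ∇ g x, v⟫_ℝ - L * s * ‖v‖ ^ 2) s := by
    have hlin := (hasDerivAt_id s).mul_const ⟪∇ g x, v⟫_ℝ
    have hquad := (((hasDerivAt_id s).pow 2).const_mul (L / 2)).mul_const (‖v‖ ^ 2)
    refine (((hasDerivAt_comp_line (hg.differentiable _)).sub hlin).sub hquad).congr_deriv ?_
    simp only [inner_sub_left, Nat.cast_ofNat, id_eq]
    ring
  have hanti : AntitoneOn gap (Set.Icc 0 1) := by
    refine antitoneOn_of_deriv_nonpos (convex_Icc 0 1)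
      (fun s _ => (hderiv s).continuousAt.continuousWithinAt)
      (fun s _ => (hderiv s).differentiableAt.differentiableWithinAt) fun s hs => ?_
    rw [interior_Icc] at hs
    have hlip := hg.norm_gradient_sub_le (x + s • v) x
    rw [add_sub_cancel_left, norm_smul, Real.norm_of_nonneg hs.1.le] at hlip
    calc deriv gap s
      _ = ⟪∇ g (x + s • v) - ∇ g x, v⟫_ℝ - L * s * ‖v‖ ^ 2 := (hderiv s).deriv
      _ ≤ L * (s * ‖v‖) * ‖v‖ - L * s * ‖v‖ ^ 2 := by
        gcongr
        exact (real_inner_le_norm _ _).trans (by gcongr)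
      _ = 0 := by ring
  have hle := hanti (by simp) (by simp) zero_le_one
  simp only [gap, zero_smul, add_zero, one_smul, hv, add_sub_cancel] at hle
  linarith

theorem apply_sub_inv_smul_le (hL : 0 < L) (hg : IsSmoothWith L g) (x v : E) :
    g (x - L⁻¹ • v) ≤ g x - L⁻¹ * ⟪∇ g x, v⟫_ℝ + L⁻¹ / 2 * ‖v‖ ^ 2 := by
  have hdescent := hg.le_add_inner_gradient x (x - L⁻¹ • v)
  rw [sub_sub_cancel_left, inner_neg_right, inner_smul_right, norm_neg, norm_smul,
    Real.norm_of_nonneg (inv_nonneg.2 hL.le)] at hdescent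
  calc g (x - L⁻¹ • v)
    _ ≤ g x + -(L⁻¹ * ⟪∇ g x, v⟫_ℝ) + L / 2 * (L⁻¹ * ‖v‖) ^ 2 := hdescent
    _ = g x - L⁻¹ * ⟪∇ g x, v⟫_ℝ + L⁻¹ / 2 * ‖v‖ ^ 2 := by field

theorem sq_norm_gradient_le (hL : 0 < L) (hg : IsSmoothWith L g) (hg0 : ∀ x, 0 ≤ g x) (x : E) :
    ‖∇ g x‖ ^ 2 ≤ 2 * L * g x := by
  have hstep := hg.apply_sub_inv_smul_le hL x (∇ g x)
  rw [real_inner_self_eq_norm_sq] at hstep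
  have hle : L⁻¹ * ‖∇ g x‖ ^ 2 ≤ 2 * g x := by linarith [hg0 (x - L⁻¹ • ∇ g x)]
  rw [inv_mul_le_iff₀ hL] at hle
  linarith

theorem le_mul_add_sq_norm_sub {γ : ℝ} (hL : 0 < L) (hγ : 0 < γ) (hg : IsSmoothWith L g)
    (hg0 : ∀ x, 0 ≤ g x) (u v : E) :
    g u ≤ (1 + L / γ) * g v + (L + γ) / 2 * ‖u - v‖ ^ 2 := by
  have hyoung : 2 * ‖∇ g v‖ * ‖u - v‖ ≤ γ⁻¹ * ‖∇ g v‖ ^ 2 + γ * ‖u - v‖ ^ 2 := by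
    simpa using two_mul_le_add_mul_sq (a := ‖∇ g v‖) (b := ‖u - v‖) (inv_pos.2 hγ)
  have hself : γ⁻¹ * ‖∇ g v‖ ^ 2 ≤ γ⁻¹ * (2 * L * g v) := by
    gcongr
    exact hg.sq_norm_gradient_le hL hg0 v
  calc g u
    _ ≤ g v + ⟪∇ g v, u - v⟫_ℝ + L / 2 * ‖u - v‖ ^ 2 := hg.le_add_inner_gradient v u
    _ ≤ g v + (γ⁻¹ * (2 * L * g v) + γ * ‖u - v‖ ^ 2) / 2 + L / 2 * ‖u - v‖ ^ 2 := by
      linarith [real_inner_le_norm (∇ g v) (u - v)]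
    _ = (1 + L / γ) * g v + (L + γ) / 2 * ‖u - v‖ ^ 2 := by ring

theorem apply_add_smul_le {r : ℝ} (hL : 0 < L) (hg : IsSmoothWith L g) (hg0 : ∀ x, 0 ≤ g x)
    (hr : 0 ≤ r) (hr1 : r ≤ 1) (x u : E) :
    g (x + r • u) ≤ (1 + r) * g x + r * (L * ‖u‖ ^ 2) := by
  rcases hr.eq_or_lt with rfl | hr
  · simp
  have hle := hg.le_mul_add_sq_norm_sub hL (div_pos hL hr) hg0 (x + r • u) x
  rw [add_sub_cancel_left, norm_smul, Real.norm_of_nonneg hr.le, div_div_cancel₀ hL.ne'] at hle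
  calc g (x + r • u)
    _ ≤ (1 + r) * g x + (L + L / r) / 2 * (r * ‖u‖) ^ 2 := hle
    _ = (1 + r) * g x + (1 + r) / 2 * (r * (L * ‖u‖ ^ 2)) := by field
    _ ≤ (1 + r) * g x + r * (L * ‖u‖ ^ 2) := by
      have hnonneg : 0 ≤ r * (L * ‖u‖ ^ 2) := by positivity
      linarith [mul_le_of_le_one_left hnonneg (show (1 + r) / 2 ≤ 1 by linarith)]

theorem add_inner_gradient_add_sq_norm_le (hL : 0 < L) (hg : IsSmoothWith L g)
    (hc : ConvexOn ℝ Set.univ g) (x y : E) :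
    g x + ⟪∇ g x, y - x⟫_ℝ + L⁻¹ / 2 * ‖∇ g y - ∇ g x‖ ^ 2 ≤ g y := by
  set D := ∇ g y - ∇ g x with hD
  have hlower := add_inner_gradient_le_of_convexOn hc (hg.differentiable x) (y - L⁻¹ • D)
  have hupper := hg.apply_sub_inv_smul_le hL y D
  rw [sub_right_comm, inner_sub_right, inner_smul_right] at hlower
  have hsq : L⁻¹ * ⟪∇ g y, D⟫_ℝ - L⁻¹ * ⟪∇ g x, D⟫_ℝ = L⁻¹ * ‖D‖ ^ 2 := by
    rw [← mul_sub, ← inner_sub_left, ← hD, real_inner_self_eq_norm_sq]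
  linarith

/-- The Baillon–Haddad theorem. -/
theorem sq_norm_gradient_sub_le (hL : 0 < L) (hg : IsSmoothWith L g)
    (hc : ConvexOn ℝ Set.univ g) (x y : E) :
    ‖∇ g x - ∇ g y‖ ^ 2 ≤ L * ⟪∇ g x - ∇ g y, x - y⟫_ℝ := by
  have hxy := hg.add_inner_gradient_add_sq_norm_le hL hc x y
  have hyx := hg.add_inner_gradient_add_sq_norm_le hL hc y x
  rw [norm_sub_rev (∇ g y), ← neg_sub x y, inner_neg_right] at hxy
  rw [← inv_mul_le_iff₀ hL, inner_sub_left]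
  linarith

theorem norm_gradientStep_sub_le (hL : 0 < L) (hg : IsSmoothWith L g)
    (hc : ConvexOn ℝ Set.univ g) (hη : 0 ≤ η) (hLη : L * η ≤ 2) (x y : E) :
    ‖(x - η • ∇ g x) - (y - η • ∇ g y)‖ ≤ ‖x - y‖ := by
  have hcoco := hg.sq_norm_gradient_sub_le hL hc x y
  rw [sub_sub_sub_comm, ← smul_sub]
  set D := ∇ g x - ∇ g y
  have hinner : 0 ≤ ⟪D, x - y⟫_ℝ := (mul_nonneg_iff_of_pos_left hL).1 ((sq_nonneg ‖D‖).trans hcoco)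
  refine le_of_sq_le_sq ?_ (norm_nonneg _)
  calc ‖(x - y) - η • D‖ ^ 2
    _ = ‖x - y‖ ^ 2 - 2 * η * ⟪D, x - y⟫_ℝ + η ^ 2 * ‖D‖ ^ 2 := by
      rw [norm_sub_sq_real, inner_smul_right, norm_smul, Real.norm_of_nonneg hη, real_inner_comm]
      ring
    _ ≤ ‖x - y‖ ^ 2 - 2 * η * ⟪D, x - y⟫_ℝ + η ^ 2 * (L * ⟪D, x - y⟫_ℝ) := by gcongr
    _ = ‖x - y‖ ^ 2 - (2 - L * η) * (η * ⟪D, x - y⟫_ℝ) := by ring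
    _ ≤ ‖x - y‖ ^ 2 := sub_le_self _ (mul_nonneg (by linarith) (mul_nonneg hη hinner))

theorem sq_norm_gradientStep_sub_le (hL : 0 < L) (hg : IsSmoothWith L g) (hh : IsSmoothWith L h)
    (hg0 : ∀ x, 0 ≤ g x) (hh0 : ∀ x, 0 ≤ h x) {p : ℝ} (hp : 0 < p) (η : ℝ) (x y : E) :
    ‖(x - η • ∇ g x) - (y - η • ∇ h y)‖ ^ 2
      ≤ (1 + p) * ‖x - y‖ ^ 2 + (1 + p⁻¹) * (4 * L * η ^ 2 * (g x + h y)) := by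
  rw [sub_sub_sub_comm, ← smul_sub]
  have hstep : ‖η • (∇ g x - ∇ h y)‖ ^ 2 ≤ 4 * L * η ^ 2 * (g x + h y) := by
    calc ‖η • (∇ g x - ∇ h y)‖ ^ 2
      _ = η ^ 2 * ‖∇ g x - ∇ h y‖ ^ 2 := by rw [norm_smul, mul_pow, Real.norm_eq_abs, sq_abs]
      _ ≤ η ^ 2 * (2 * (‖∇ g x‖ ^ 2 + ‖∇ h y‖ ^ 2)) := by
        gcongr
        exact (pow_le_pow_left₀ (norm_nonneg _) (norm_sub_le _ _) 2).trans add_sq_le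
      _ ≤ η ^ 2 * (2 * (2 * L * g x + 2 * L * h y)) := by
        gcongr
        · exact hg.sq_norm_gradient_le hL hg0 x
        · exact hh.sq_norm_gradient_le hL hh0 y
      _ = 4 * L * η ^ 2 * (g x + h y) := by ring
  set v := η • (∇ g x - ∇ h y)
  calc ‖(x - y) - v‖ ^ 2
    _ ≤ (‖x - y‖ + ‖v‖) ^ 2 := by gcongr; exact norm_sub_le _ _
    _ ≤ (1 + p) * ‖x - y‖ ^ 2 + (1 + p⁻¹) * ‖v‖ ^ 2 := by
      linarith [two_mul_le_add_mul_sq (a := ‖x - y‖) (b := ‖v‖) hp]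
    _ ≤ (1 + p) * ‖x - y‖ ^ 2 + (1 + p⁻¹) * (4 * L * η ^ 2 * (g x + h y)) := by gcongr

end IsSmoothWith

end Smooth

section Projection

variable {d : ℕ} {Ω : Set (Param d)} {x y : Param d}

/-- The conditions on the constraint set under which `projOn` is the Euclidean projection. -/
structure IsFeasibleSet (Ω : Set (Param d)) : Prop where
  nonempty : Ω.Nonempty
  isClosed : IsClosed Ω
  convex : Convex ℝ Ω

namespace IsFeasibleSet

theorem projOn_mem (hΩ : IsFeasibleSet Ω) (x : Param d) : projOn Ω x ∈ Ω :=
  (projOn_spec hΩ.nonempty hΩ.isClosed hΩ.convex x).1.1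

theorem projOn_eq_self (hΩ : IsFeasibleSet Ω) (hy : y ∈ Ω) : projOn Ω y = y :=
  ((projOn_spec hΩ.nonempty hΩ.isClosed hΩ.convex y).2 y hy
    (by rw [dist_self, Metric.infDist_zero_of_mem hy])).symm

theorem inner_sub_projOn_nonpos (hΩ : IsFeasibleSet Ω) (x : Param d) (hy : y ∈ Ω) :
    ⟪x - projOn Ω x, y - projOn Ω x⟫_ℝ ≤ 0 := by
  have hdist := (projOn_spec hΩ.nonempty hΩ.isClosed hΩ.convex x).1.2
  refine (norm_eq_iInf_iff_real_inner_le_zero hΩ.convex (hΩ.projOn_mem x)).1 ?_ y hy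
  simpa only [dist_eq_norm, Metric.infDist_eq_iInf] using hdist

theorem norm_projOn_sub_projOn_le (hΩ : IsFeasibleSet Ω) (x y : Param d) :
    ‖projOn Ω x - projOn Ω y‖ ≤ ‖x - y‖ := by
  have hx := hΩ.inner_sub_projOn_nonpos x (hΩ.projOn_mem y)
  have hy := hΩ.inner_sub_projOn_nonpos y (hΩ.projOn_mem x)
  set p := projOn Ω x
  set q := projOn Ω y
  have hsplit : ⟪x - y, p - q⟫_ℝ
      = ‖p - q‖ ^ 2 - ⟪x - p, q - p⟫_ℝ - ⟪y - q, p - q⟫_ℝ := by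
    rw [← real_inner_self_eq_norm_sq, ← neg_sub p q, inner_neg_right, sub_neg_eq_add,
      ← inner_add_left, ← inner_sub_left]
    congr 1
    abel
  have hmul : ‖p - q‖ * ‖p - q‖ ≤ ‖x - y‖ * ‖p - q‖ := by
    linarith [real_inner_le_norm (x - y) (p - q)]
  rcases (norm_nonneg (p - q)).eq_or_lt with h0 | hpos
  · exact h0.symm.trans_le (norm_nonneg _)
  · exact le_of_mul_le_mul_right hmul hpos

theorem norm_projOn_sub_le (hΩ : IsFeasibleSet Ω) (x : Param d) (hy : y ∈ Ω) :
    ‖projOn Ω x - y‖ ≤ ‖x - y‖ := by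
  simpa [hΩ.projOn_eq_self hy] using hΩ.norm_projOn_sub_projOn_le x y

theorem continuous_projOn (hΩ : IsFeasibleSet Ω) : Continuous (projOn Ω) :=
  (LipschitzWith.mk_one
    (by simpa only [dist_eq_norm] using hΩ.norm_projOn_sub_projOn_le)).continuous

end IsFeasibleSet

end Projection

section WeightedAverage

theorem sq_norm_centerMass_sub_centerMass_le {ι E : Type*} [SeminormedAddCommGroup E]
    [NormedSpace ℝ E] {s : Finset ι} {c : ι → ℝ} (hc : ∀ i ∈ s, 0 ≤ c i)
    (hcs : 0 < ∑ i ∈ s, c i) (x y : ι → E) :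
    ‖s.centerMass c x - s.centerMass c y‖ ^ 2 ≤ s.centerMass c fun i => ‖x i - y i‖ ^ 2 := by
  have hconv : ConvexOn ℝ Set.univ fun v : E => ‖v‖ ^ 2 :=
    convexOn_univ_norm.pow (fun v _ => norm_nonneg v) 2
  have hsub : s.centerMass c x - s.centerMass c y = s.centerMass c fun i => x i - y i := by
    simp only [Finset.centerMass, ← smul_sub, ← Finset.sum_sub_distrib]
  rw [hsub]
  exact hconv.map_centerMass_le hc hcs fun _ _ => Set.mem_univ _

theorem centerMass_le_of_forall_le {ι : Type*} {s : Finset ι} {c x : ι → ℝ} {B : ℝ}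
    (hc : ∀ i ∈ s, 0 ≤ c i) (hcs : 0 < ∑ i ∈ s, c i) (hx : ∀ i ∈ s, x i ≤ B) :
    s.centerMass c x ≤ B :=
  (convex_Iic B).centerMass_mem hc hcs hx

variable {ι α E : Type*} [MeasurableSpace α] {μ : Measure α} [NormedAddCommGroup E]
  [NormedSpace ℝ E] {s : Finset ι} {c : ι → ℝ} {G : ι → α → E}

theorem integrable_centerMass (hG : ∀ i, Integrable (G i) μ) :
    Integrable (fun x => s.centerMass c fun i => G i x) μ :=
  (integrable_finsetSum s fun i _ => (hG i).fun_smul (c i)).fun_smul _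

theorem integral_centerMass (hG : ∀ i, Integrable (G i) μ) :
    ∫ x, s.centerMass c (fun i => G i x) ∂μ = s.centerMass c fun i => ∫ x, G i x ∂μ := by
  simp only [Finset.centerMass, integral_smul]
  rw [integral_finsetSum s fun i _ => (hG i).fun_smul (c i)]
  simp only [integral_smul]

end WeightedAverage

section Path

variable {d n : ℕ} {Z : Type*} {L M : ℝ} {Ω : Set (Param d)} {f : Param d → Z → ℝ} {η : ℕ → ℝ}
  {u : Param d}

theorem dependsOn_sgd (Ω : Set (Param d)) (f : Param d → Z → ℝ) (η : ℕ → ℝ) (S : Fin n → Z)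
    (t : ℕ) : DependsOn (fun i => sgd Ω f η S i t) (Finset.range t) := by
  induction t with
  | zero => exact fun _ _ _ => rfl
  | succ t ih =>
    intro i j hij
    have hw : sgd Ω f η S i t = sgd Ω f η S j t :=
      ih.mono (Finset.coe_subset.2 (Finset.range_mono t.le_succ)) hij
    simp only [sgd, hw, hij t (Finset.mem_coe.2 (Finset.self_mem_range_succ t))]

theorem dependsOn_sgdAverage (Ω : Set (Param d)) (f : Param d → Z → ℝ) (η : ℕ → ℝ)
    (S : Fin n → Z) (T : ℕ) : DependsOn (fun i => sgdAverage Ω f η S i T) (Finset.range T) := by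
  intro i j hij
  simp only [sgdAverage]
  congr 1
  refine Finset.sum_congr rfl fun t ht => congrArg (η t • ·) ?_
  exact (dependsOn_sgd Ω f η S t).mono
    (Finset.coe_subset.2 (Finset.range_mono (Finset.mem_range.1 ht).le)) hij

theorem sgdAverage_eq_centerMass (S : Fin n → Z) (i : ℕ → Fin n) (T : ℕ) :
    sgdAverage Ω f η S i T = (Finset.range T).centerMass η (sgd Ω f η S i) :=
  rfl

/-- A bound on the squared distance of the first `T` iterates to `u` that does not depend on the
drawn indices; it makes the losses along the iterates integrable over the sample. -/
noncomputable def sqRadius (f : Param d → Z → ℝ) (η : ℕ → ℝ) (u : Param d) (T : ℕ)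
    (S : Fin n → Z) : ℝ :=
  ‖u‖ ^ 2 + 2 * (∑ t ∈ Finset.range T, η t) * ∑ k, f u (S k)

theorem sq_norm_projOn_gradientStep_sub_le {g : Param d → ℝ} {a : ℝ} (hL : 0 < L)
    (hΩ : IsFeasibleSet Ω) (hg : IsSmoothWith L g) (hc : ConvexOn ℝ Set.univ g)
    (hg0 : ∀ w, 0 ≤ g w) (ha : 0 ≤ a) (hu : u ∈ Ω) (w : Param d) :
    ‖projOn Ω (w - a • ∇ g w) - u‖ ^ 2 + 2 * a * (1 - L * a) * g w
      ≤ ‖w - u‖ ^ 2 + 2 * a * g u := by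
  have hproj : ‖projOn Ω (w - a • ∇ g w) - u‖ ^ 2 ≤ ‖w - u - a • ∇ g w‖ ^ 2 := by
    rw [sub_right_comm]
    gcongr
    exact hΩ.norm_projOn_sub_le _ hu
  have hconvex : g w - g u ≤ ⟪w - u, ∇ g w⟫_ℝ := by
    have := add_inner_gradient_le_of_convexOn hc (hg.differentiable w) u
    rw [← neg_sub w u, inner_neg_right, real_inner_comm] at this
    linarith
  have hexpand : ‖w - u - a • ∇ g w‖ ^ 2
      = ‖w - u‖ ^ 2 - 2 * a * ⟪w - u, ∇ g w⟫_ℝ + a ^ 2 * ‖∇ g w‖ ^ 2 := by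
    rw [norm_sub_sq_real, inner_smul_right, norm_smul, mul_pow, Real.norm_eq_abs, sq_abs]
    ring
  calc ‖projOn Ω (w - a • ∇ g w) - u‖ ^ 2 + 2 * a * (1 - L * a) * g w
    _ ≤ ‖w - u‖ ^ 2 - 2 * a * ⟪w - u, ∇ g w⟫_ℝ + a ^ 2 * ‖∇ g w‖ ^ 2
          + 2 * a * (1 - L * a) * g w := by linarith
    _ ≤ ‖w - u‖ ^ 2 - 2 * a * (g w - g u) + a ^ 2 * (2 * L * g w)
          + 2 * a * (1 - L * a) * g w := by
      gcongr
      exact hg.sq_norm_gradient_le hL hg0 w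
    _ = ‖w - u‖ ^ 2 + 2 * a * g u := by ring

namespace IsSmoothConvexLoss

theorem isSmoothWith (hf : IsSmoothConvexLoss L f) (z : Z) : IsSmoothWith L fun w => f w z :=
  ⟨hf.differentiable z, hf.smooth z⟩

theorem loss_le_of_sq_norm_sub_le (hL : 0 < L) (hf : IsSmoothConvexLoss L f) {w : Param d} {B : ℝ}
    (hB : ‖w - u‖ ^ 2 ≤ B) (z : Z) : f w z ≤ 2 * f u z + L * B :=
  calc f w z
    _ ≤ (1 + L / L) * f u z + (L + L) / 2 * ‖w - u‖ ^ 2 :=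
      (hf.isSmoothWith z).le_mul_add_sq_norm_sub hL hL (fun w => hf.nonneg w z) w u
    _ ≤ 2 * f u z + L * B := by
      rw [div_self hL.ne', one_add_one_eq_two, add_self_div_two]
      gcongr

theorem sq_norm_sgd_sub_add_sum_le (hL : 0 < L) (hΩ : IsFeasibleSet Ω)
    (hf : IsSmoothConvexLoss L f) (hη : ∀ t, 0 ≤ η t) (hu : u ∈ Ω) (S : Fin n → Z)
    (i : ℕ → Fin n) (T : ℕ) :
    ‖sgd Ω f η S i T - u‖ ^ 2
        + ∑ t ∈ Finset.range T, 2 * η t * (1 - L * η t) * f (sgd Ω f η S i t) (S (i t))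
      ≤ ‖u‖ ^ 2 + ∑ t ∈ Finset.range T, 2 * η t * f u (S (i t)) := by
  induction T with
  | zero => simp [sgd]
  | succ T ih =>
    have hstep := sq_norm_projOn_gradientStep_sub_le hL hΩ (hf.isSmoothWith (S (i T)))
      (hf.convex _) (fun w => hf.nonneg w _) (hη T) hu (sgd Ω f η S i T)
    rw [Finset.sum_range_succ, Finset.sum_range_succ, sgd]
    linarith

theorem sum_mul_loss_sgd_le (hL : 0 < L) (hΩ : IsFeasibleSet Ω) (hf : IsSmoothConvexLoss L f)
    (hη : ∀ t, 0 ≤ η t) (hηM : ∀ t, η t ≤ M) (hLM : L * M ≤ 1 / 2) (hu : u ∈ Ω) (S : Fin n → Z)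
    (i : ℕ → Fin n) (T : ℕ) :
    ∑ t ∈ Finset.range T, η t * f (sgd Ω f η S i t) (S (i t))
      ≤ (1 + 2 * L * M) * (‖u‖ ^ 2 / 2 + ∑ t ∈ Finset.range T, η t * f u (S (i t))) := by
  have hM : 0 ≤ M := (hη 0).trans (hηM 0)
  have hregret := hf.sq_norm_sgd_sub_add_sum_le hL hΩ hη hu S i T
  have hfactor : (1 - L * M) * ∑ t ∈ Finset.range T, η t * f (sgd Ω f η S i t) (S (i t))
      ≤ ‖u‖ ^ 2 / 2 + ∑ t ∈ Finset.range T, η t * f u (S (i t)) := by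
    have hterm (t : ℕ) : (1 - L * M) * (η t * f (sgd Ω f η S i t) (S (i t)))
        ≤ 2 * η t * (1 - L * η t) * f (sgd Ω f η S i t) (S (i t)) / 2 := by
      have hw := mul_nonneg (hη t) (hf.nonneg (sgd Ω f η S i t) (S (i t)))
      have hle : 1 - L * M ≤ 1 - L * η t := by gcongr; exact hηM t
      linarith [mul_le_mul_of_nonneg_right hle hw]
    calc (1 - L * M) * ∑ t ∈ Finset.range T, η t * f (sgd Ω f η S i t) (S (i t))
      _ ≤ (∑ t ∈ Finset.range T,
            2 * η t * (1 - L * η t) * f (sgd Ω f η S i t) (S (i t))) / 2 := by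
        rw [Finset.mul_sum, Finset.sum_div]
        exact Finset.sum_le_sum fun t _ => hterm t
      _ ≤ (‖u‖ ^ 2 + ∑ t ∈ Finset.range T, 2 * η t * f u (S (i t))) / 2 := by
        linarith [sq_nonneg ‖sgd Ω f η S i T - u‖]
      _ = ‖u‖ ^ 2 / 2 + ∑ t ∈ Finset.range T, η t * f u (S (i t)) := by
        simp only [mul_assoc, ← Finset.mul_sum]
        ring
  have hsum : 0 ≤ ∑ t ∈ Finset.range T, η t * f (sgd Ω f η S i t) (S (i t)) :=
    Finset.sum_nonneg fun t _ => mul_nonneg (hη t) (hf.nonneg _ _)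
  have hone : 1 ≤ (1 + 2 * L * M) * (1 - L * M) := by nlinarith [mul_nonneg hL.le hM]
  calc ∑ t ∈ Finset.range T, η t * f (sgd Ω f η S i t) (S (i t))
    _ ≤ (1 + 2 * L * M) * (1 - L * M)
          * ∑ t ∈ Finset.range T, η t * f (sgd Ω f η S i t) (S (i t)) :=
      le_mul_of_one_le_left hsum hone
    _ ≤ (1 + 2 * L * M) * (‖u‖ ^ 2 / 2 + ∑ t ∈ Finset.range T, η t * f u (S (i t))) := by
      rw [mul_assoc]
      gcongr

theorem sq_norm_sgd_sub_le (hL : 0 < L) (hΩ : IsFeasibleSet Ω) (hf : IsSmoothConvexLoss L f)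
    (hη : ∀ t, 0 ≤ η t) (hLη : ∀ t, L * η t ≤ 1) (hu : u ∈ Ω) (S : Fin n → Z) (i : ℕ → Fin n)
    (T : ℕ) :
    ‖sgd Ω f η S i T - u‖ ^ 2 ≤ sqRadius f η u T S := by
  have hregret := hf.sq_norm_sgd_sub_add_sum_le hL hΩ hη hu S i T
  have hsum : 0 ≤ ∑ t ∈ Finset.range T,
      2 * η t * (1 - L * η t) * f (sgd Ω f η S i t) (S (i t)) :=
    Finset.sum_nonneg fun t _ => mul_nonneg (mul_nonneg (mul_nonneg zero_le_two (hη t))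
      (sub_nonneg.2 (hLη t))) (hf.nonneg _ _)
  have hloss : ∑ t ∈ Finset.range T, 2 * η t * f u (S (i t))
      ≤ 2 * (∑ t ∈ Finset.range T, η t) * ∑ k, f u (S k) := by
    rw [Finset.mul_sum _ _ (2 : ℝ), Finset.sum_mul]
    refine Finset.sum_le_sum fun t _ => mul_le_mul_of_nonneg_left ?_ (by linarith [hη t])
    exact Finset.single_le_sum (f := fun k => f u (S k)) (fun k _ => hf.nonneg u (S k))
      (Finset.mem_univ (i t))
  rw [sqRadius]
  linarith

theorem sq_norm_sgdAverage_sub_le (hL : 0 < L) (hΩ : IsFeasibleSet Ω)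
    (hf : IsSmoothConvexLoss L f) (hη : ∀ t, 0 ≤ η t) (hLη : ∀ t, L * η t ≤ 1) {T : ℕ}
    (hsum : 0 < ∑ t ∈ Finset.range T, η t) (hu : u ∈ Ω) (S : Fin n → Z) (i : ℕ → Fin n) :
    ‖sgdAverage Ω f η S i T - u‖ ^ 2 ≤ sqRadius f η u T S := by
  have hcm := sq_norm_centerMass_sub_centerMass_le (fun t _ => hη t) hsum (sgd Ω f η S i)
    (Function.const ℕ u)
  rw [Finset.centerMass_const hsum.ne'] at hcm
  rw [sgdAverage_eq_centerMass]
  refine hcm.trans (centerMass_le_of_forall_le (fun t _ => hη t) hsum fun t ht => ?_)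
  refine (hf.sq_norm_sgd_sub_le hL hΩ hη hLη hu S i t).trans ?_
  have hloss : 0 ≤ ∑ k, f u (S k) := Finset.sum_nonneg fun k _ => hf.nonneg u (S k)
  have hmono : ∑ s ∈ Finset.range t, η s ≤ ∑ s ∈ Finset.range T, η s :=
    Finset.sum_le_sum_of_subset_of_nonneg
      (Finset.range_mono (Finset.mem_range.1 ht).le) fun s _ _ => hη s
  unfold sqRadius
  gcongr

theorem sq_norm_sgd_succ_sub_le (hL : 0 < L) (hΩ : IsFeasibleSet Ω) (hf : IsSmoothConvexLoss L f)
    (hη : ∀ t, 0 ≤ η t) (hLη : ∀ t, L * η t ≤ 2) {p : ℝ} (hp : 0 < p) {S S' : Fin n → Z}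
    {k : Fin n} (hS : ∀ j, j ≠ k → S j = S' j) (i : ℕ → Fin n) (t : ℕ) :
    ‖sgd Ω f η S i (t + 1) - sgd Ω f η S' i (t + 1)‖ ^ 2
      ≤ ‖sgd Ω f η S i t - sgd Ω f η S' i t‖ ^ 2
        + if i t = k then p * ‖sgd Ω f η S i t - sgd Ω f η S' i t‖ ^ 2
            + (1 + p⁻¹) * (4 * L * η t ^ 2
              * (f (sgd Ω f η S i t) (S k) + f (sgd Ω f η S' i t) (S' k)))
          else 0 := by
  rw [sgd, sgd]
  refine (pow_le_pow_left₀ (norm_nonneg _) (hΩ.norm_projOn_sub_projOn_le _ _) 2).trans ?_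
  split_ifs with hk
  · rw [hk]
    refine ((hf.isSmoothWith (S k)).sq_norm_gradientStep_sub_le hL (hf.isSmoothWith (S' k))
      (fun w => hf.nonneg w _) (fun w => hf.nonneg w _) hp _ _ _).trans_eq ?_
    ring
  · rw [hS _ hk, add_zero]
    gcongr
    exact (hf.isSmoothWith _).norm_gradientStep_sub_le hL (hf.convex _) (hη t) (hLη t) _ _

end IsSmoothConvexLoss

end Path

section Measurability

variable {d n : ℕ} {Z : Type*} [MeasurableSpace Z] {L : ℝ} {Ω : Set (Param d)}
  {f : Param d → Z → ℝ}

theorem measurable_inner_gradient {E : Type*} [NormedAddCommGroup E] [InnerProductSpace ℝ E]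
    [CompleteSpace E] {f : E → Z → ℝ} (hm : ∀ w, Measurable (f w)) {w : E}
    (hd : ∀ z, DifferentiableAt ℝ (fun u => f u z) w) (v : E) :
    Measurable fun z => ⟪∇ (fun u => f u z) w, v⟫_ℝ := by
  have hstep : Filter.Tendsto (fun m : ℕ => 1 / ((m : ℝ) + 1)) Filter.atTop
      (nhdsWithin 0 {0}ᶜ) :=
    tendsto_nhdsWithin_iff.2 ⟨tendsto_one_div_add_atTop_nhds_zero_nat,
      Filter.Eventually.of_forall fun m => Nat.one_div_pos_of_nat.ne'⟩
  refine measurable_of_tendsto_metrizable (f := fun (m : ℕ) z =>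
    (1 / ((m : ℝ) + 1))⁻¹ * (f (w + (1 / ((m : ℝ) + 1)) • v) z - f w z))
    (fun m => ((hm _).sub (hm _)).const_mul _) (tendsto_pi_nhds.2 fun z => ?_)
  have hslope := (hasDerivAt_comp_line (s := 0) (v := v) (by simpa using hd z)).tendsto_slope_zero
  simpa [Function.comp_def] using hslope.comp hstep

theorem measurable_gradient_right (hm : ∀ w, Measurable (f w)) {w : Param d}
    (hd : ∀ z, DifferentiableAt ℝ (fun u => f u z) w) :
    Measurable fun z => ∇ (fun u => f u z) w := by
  let b := EuclideanSpace.basisFun (Fin d) ℝ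
  have hsum : (fun z => ∇ (fun u => f u z) w) = fun z =>
      ∑ j, ⟪∇ (fun u => f u z) w, b j⟫_ℝ • b j := by
    funext z
    simpa only [real_inner_comm] using (b.sum_repr' (∇ (fun u => f u z) w)).symm
  rw [hsum]
  exact Finset.measurable_sum _ fun j _ => (measurable_inner_gradient hm hd _).smul_const _

theorem measurable_sample_index (t : ℕ) :
    Measurable fun p : (Fin n → Z) × (ℕ → Fin n) => p.1 (p.2 t) := by
  have heval : Measurable fun q : (Fin n → Z) × Fin n => q.1 q.2 :=
    measurable_from_prod_countable_left fun k => measurable_pi_apply k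
  exact heval.comp (measurable_fst.prodMk ((measurable_pi_apply t).comp measurable_snd))

namespace IsSmoothConvexLoss

theorem measurable_uncurry (hf : IsSmoothConvexLoss L f) (hm : ∀ w, Measurable (f w)) :
    Measurable (Function.uncurry f) :=
  measurable_uncurry_of_continuous_of_measurable (u := f)
    (fun z => (hf.differentiable z).continuous) hm

theorem measurable_uncurry_gradient (hf : IsSmoothConvexLoss L f) (hm : ∀ w, Measurable (f w)) :
    Measurable (Function.uncurry fun w z => ∇ (fun u => f u z) w) :=
  measurable_uncurry_of_continuous_of_measurable (u := fun w z => ∇ (fun u => f u z) w)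
    (fun z => (hf.isSmoothWith z).continuous_gradient)
    fun w => measurable_gradient_right hm fun z => hf.differentiable z w

theorem measurable_sgd (hΩ : IsFeasibleSet Ω) (hf : IsSmoothConvexLoss L f)
    (hm : ∀ w, Measurable (f w)) (η : ℕ → ℝ) (t : ℕ) :
    Measurable fun p : (Fin n → Z) × (ℕ → Fin n) => sgd Ω f η p.1 p.2 t := by
  induction t with
  | zero => exact measurable_const
  | succ t ih =>
    simp only [sgd]
    refine hΩ.continuous_projOn.measurable.comp (ih.sub ?_)
    exact ((hf.measurable_uncurry_gradient hm).comp
      (ih.prodMk (measurable_sample_index t))).const_smul (η t)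

theorem measurable_sgdAverage (hΩ : IsFeasibleSet Ω) (hf : IsSmoothConvexLoss L f)
    (hm : ∀ w, Measurable (f w)) (η : ℕ → ℝ) (T : ℕ) :
    Measurable fun p : (Fin n → Z) × (ℕ → Fin n) => sgdAverage Ω f η p.1 p.2 T := by
  unfold sgdAverage
  exact (Finset.measurable_sum _ fun t _ => (hf.measurable_sgd hΩ hm η t).const_smul
    (η t)).const_smul (∑ t ∈ Finset.range T, η t)⁻¹

end IsSmoothConvexLoss

end Measurability

section FiniteDependence

theorem dependsOn_eval_insert {ι α β : Type*} [DecidableEq ι] {s : Finset ι} (t : ι)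
    {H : (ι → α) → α → β} (hH : ∀ k, DependsOn (fun i => H i k) s) :
    DependsOn (fun i => H i (i t)) (insert t s : Finset ι) := by
  intro i j hij
  have hfirst : H i (i t) = H j (i t) :=
    (hH (i t)).mono (Finset.coe_subset.2 (Finset.subset_insert t s)) hij
  exact hfirst.trans (by rw [hij t (Finset.mem_insert_self t s)])

variable {ι α : Type*} [MeasurableSpace α] [MeasurableSingletonClass α]

theorem integrable_of_dependsOn [Finite α] (μ : Measure (ι → α)) [IsFiniteMeasure μ]
    {s : Finset ι} {G : (ι → α) → ℝ} (hG : DependsOn G s) : Integrable G μ := by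
  obtain ⟨g, rfl⟩ := dependsOn_iff_exists_comp.1 hG
  exact Integrable.of_finite.comp_measurable (measurable_pi_lambda _ fun j => measurable_pi_apply _)

variable (ν : ι → Measure α) [∀ j, IsProbabilityMeasure (ν j)]

theorem integral_infinitePi_ite_eval_mul [Finite α] [DecidableEq α] {s : Finset ι} {t : ι}
    (ht : t ∉ s) {G : (ι → α) → ℝ} (hG : DependsOn G s) (k : α) :
    ∫ i, (if i t = k then 1 else 0) * G i ∂(Measure.infinitePi ν)
      = (ν t).real {k} * ∫ i, G i ∂(Measure.infinitePi ν) := by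
  obtain ⟨g, rfl⟩ := dependsOn_iff_exists_comp.1 hG
  have hindep : iIndepFun (fun j (i : ι → α) => i j) (Measure.infinitePi ν) :=
    iIndepFun_infinitePi (X := fun _ x => x) fun _ => measurable_id
  have hpair := (hindep.indepFun_finset {t} s (Finset.disjoint_singleton_left.2 ht)
    fun j => measurable_pi_apply j).comp
    (φ := fun x => if x ⟨t, Finset.mem_singleton_self t⟩ = k then (1 : ℝ) else 0) (ψ := g)
    (measurable_of_finite _) (measurable_of_finite _)
  have hindicator : ∫ i, (if i t = k then (1 : ℝ) else 0) ∂(Measure.infinitePi ν)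
      = (ν t).real {k} := by
    cases nonempty_fintype α
    have hmap := integral_map (μ := Measure.infinitePi ν) (φ := fun i => i t)
      (f := fun j => if j = k then (1 : ℝ) else 0) (measurable_pi_apply t).aemeasurable
      (measurable_of_finite _).aestronglyMeasurable
    rw [← hmap, Measure.infinitePi_map_eval, integral_fintype Integrable.of_finite]
    simp
  rw [← hindicator]
  exact hpair.integral_fun_mul_eq_mul_integral
    ((measurable_of_finite _).comp (by fun_prop)).aestronglyMeasurable
    ((measurable_of_finite _).comp (by fun_prop)).aestronglyMeasurable

theorem integral_infinitePi_eval [Fintype α] {s : Finset ι} {t : ι} (ht : t ∉ s)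
    {H : (ι → α) → α → ℝ} (hH : ∀ k, DependsOn (fun i => H i k) s) :
    ∫ i, H i (i t) ∂(Measure.infinitePi ν)
      = ∑ k, (ν t).real {k} * ∫ i, H i k ∂(Measure.infinitePi ν) := by
  classical
  have hsplit (i : ι → α) : H i (i t) = ∑ k, (if i t = k then 1 else 0) * H i k := by simp
  simp only [hsplit]
  rw [integral_finsetSum _ fun k _ => ?_]
  · exact Finset.sum_congr rfl fun k _ => integral_infinitePi_ite_eval_mul ν ht (hH k) k
  · exact integrable_of_dependsOn _ (dependsOn_eval_insert t
      (H := fun i j => (if j = k then 1 else 0) * H i k)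
      fun j _ _ hij => congrArg _ (hH k hij))

end FiniteDependence

section IndexLaw

/-- The law of the drawn indices: i.i.d. and uniform on the `n` sample positions. -/
noncomputable abbrev indexLaw (n : ℕ) [NeZero n] : Measure (ℕ → Fin n) :=
  Measure.infinitePi fun _ : ℕ => (PMF.uniformOfFintype (Fin n)).toMeasure

variable {n : ℕ} [NeZero n]

theorem integral_indexLaw_eval {H : (ℕ → Fin n) → Fin n → ℝ} {t : ℕ}
    (hH : ∀ k, DependsOn (fun i => H i k) (Finset.range t)) :
    ∫ i, H i (i t) ∂(indexLaw n) = (n : ℝ)⁻¹ * ∑ k, ∫ i, H i k ∂(indexLaw n) := by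
  have huniform (k : Fin n) :
      (PMF.uniformOfFintype (Fin n)).toMeasure.real {k} = (n : ℝ)⁻¹ := by
    simp [measureReal_def]
  rw [integral_infinitePi_eval _ Finset.notMem_range_self hH]
  simp only [huniform, Finset.mul_sum]

theorem integrable_indexLaw_eval {H : (ℕ → Fin n) → Fin n → ℝ} {t : ℕ}
    (hH : ∀ k, DependsOn (fun i => H i k) (Finset.range t)) :
    Integrable (fun i => H i (i t)) (indexLaw n) :=
  integrable_of_dependsOn _ (dependsOn_eval_insert t hH)

variable {d : ℕ} {Z : Type*} {Ω : Set (Param d)} {f : Param d → Z → ℝ}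

theorem integrable_comp_sgd_sgd (g : Param d → Param d → ℝ) (η : ℕ → ℝ) (S S' : Fin n → Z)
    (t : ℕ) : Integrable (fun i => g (sgd Ω f η S i t) (sgd Ω f η S' i t)) (indexLaw n) :=
  integrable_of_dependsOn _ fun _ _ hij =>
    congrArg₂ g (dependsOn_sgd Ω f η S t hij) (dependsOn_sgd Ω f η S' t hij)

theorem integrable_comp_sgd (g : Param d → ℝ) (η : ℕ → ℝ) (S : Fin n → Z) (t : ℕ) :
    Integrable (fun i => g (sgd Ω f η S i t)) (indexLaw n) :=
  integrable_comp_sgd_sgd (fun w _ => g w) η S S t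

theorem integrable_comp_sgdAverage_sgdAverage (g : Param d → Param d → ℝ) (η : ℕ → ℝ)
    (S S' : Fin n → Z) (T : ℕ) :
    Integrable (fun i => g (sgdAverage Ω f η S i T) (sgdAverage Ω f η S' i T)) (indexLaw n) :=
  integrable_of_dependsOn _ fun _ _ hij =>
    congrArg₂ g (dependsOn_sgdAverage Ω f η S T hij) (dependsOn_sgdAverage Ω f η S' T hij)

theorem integrable_comp_sgdAverage (g : Param d → ℝ) (η : ℕ → ℝ) (S : Fin n → Z) (T : ℕ) :
    Integrable (fun i => g (sgdAverage Ω f η S i T)) (indexLaw n) :=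
  integrable_comp_sgdAverage_sgdAverage (fun w _ => g w) η S S T

end IndexLaw

section Exchange

variable {ι Z : Type*} [DecidableEq ι] [MeasurableSpace Z]

/-- The exchange of the `k`-th sample point with an additional point, as used in the definition of
on-average stability. -/
def exchange (k : ι) : (ι → Z) × Z ≃ᵐ (ι → Z) × Z :=
  MeasurableEquiv.ofInvolutive (fun p => (Function.update p.1 k p.2, p.1 k))
    (fun p => by simp) (by fun_prop)

@[simp]
theorem exchange_apply (k : ι) (p : (ι → Z) × Z) :
    exchange k p = (Function.update p.1 k p.2, p.1 k) :=
  rfl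

theorem measurePreserving_exchange [Fintype ι] (ρ : Measure Z) [IsProbabilityMeasure ρ] (k : ι) :
    MeasurePreserving (exchange k) ((Measure.pi fun _ : ι => ρ).prod ρ)
      ((Measure.pi fun _ : ι => ρ).prod ρ) := by
  let split : (ι ⊕ Unit → Z) → (ι → Z) × Z := fun s => (fun j => s (Sum.inl j), s (Sum.inr ()))
  have hsplit : MeasurePreserving split (Measure.pi fun _ => ρ)
      ((Measure.pi fun _ : ι => ρ).prod ρ) :=
    ((MeasurePreserving.id (Measure.pi fun _ : ι => ρ)).prod
      (measurePreserving_funUnique ρ Unit)).comp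
      (measurePreserving_sumPiEquivProdPi (X := fun _ : ι ⊕ Unit => Z) fun _ => ρ)
  let transpose : (ι ⊕ Unit → Z) → (ι ⊕ Unit → Z) :=
    fun s j => s (Equiv.swap (Sum.inl k) (Sum.inr ()) j)
  have htranspose : MeasurePreserving transpose (Measure.pi fun _ => ρ) (Measure.pi fun _ => ρ) :=
    (measurePreserving_piCongrLeft (fun _ : ι ⊕ Unit => ρ)
      (Equiv.swap (Sum.inl k) (Sum.inr ()))).symm
  refine hsplit.of_semiconj htranspose (fun s => ?_) (exchange k).measurable
  refine Prod.ext (funext fun j => ?_) (by simp [split, transpose])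
  obtain rfl | hj := eq_or_ne j k
  · simp [split, transpose]
  · have hswap : Equiv.swap (Sum.inl k) (Sum.inr ()) (Sum.inl j : ι ⊕ Unit) = Sum.inl j :=
      Equiv.swap_apply_of_ne_of_ne (Sum.inl_injective.ne hj) Sum.inl_ne_inr
    simp [split, transpose, hj, hswap]

end Exchange

section Gronwall

theorem le_three_mul_sum_of_succ_le {x b : ℕ → ℝ} {t T : ℕ} (hT : 0 < T) (hx0 : x 0 = 0)
    (hb : ∀ s, 0 ≤ b s) (hx : ∀ s, x (s + 1) ≤ (1 + (T : ℝ)⁻¹) * x s + b s) (htT : t ≤ T) :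
    x t ≤ 3 * ∑ s ∈ Finset.range T, b s := by
  have hexp : Real.exp (∑ _s ∈ Finset.range t, (T : ℝ)⁻¹) ≤ 3 := by
    refine (Real.exp_le_exp.2 ?_).trans Real.exp_one_lt_three.le
    rw [Finset.sum_const, Finset.card_range, nsmul_eq_mul, ← div_eq_mul_inv]
    exact div_le_one_of_le₀ (Nat.cast_le.2 htT) (Nat.cast_nonneg T)
  have hgronwall := discrete_gronwall (c := fun _ => (T : ℝ)⁻¹) hx0.ge (fun s _ => hx s)
    (fun _ _ => by positivity) (fun s _ => hb s) t.zero_le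
  rw [hx0, zero_add, ← Finset.range_eq_Ico, mul_comm] at hgronwall
  refine hgronwall.trans (mul_le_mul hexp ?_ (Finset.sum_nonneg fun s _ => hb s) zero_le_three)
  exact Finset.sum_le_sum_of_subset_of_nonneg (Finset.range_mono htT) fun s _ _ => hb s

end Gronwall

section FixedSample

variable {d n : ℕ} [NeZero n] {Z : Type*} {L M : ℝ} {Ω : Set (Param d)} {f : Param d → Z → ℝ}
  {η : ℕ → ℝ} {S S' : Fin n → Z} {k : Fin n} {T : ℕ}

/-- The expectation, over the drawn indices, of the loss at the sample point `z_k` of the iterate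
`sgd Ω f η S i t`. -/
noncomputable def expLoss (Ω : Set (Param d)) (f : Param d → Z → ℝ) (η : ℕ → ℝ) (t : ℕ)
    (S : Fin n → Z) (k : Fin n) : ℝ :=
  ∫ i, f (sgd Ω f η S i t) (S k) ∂(indexLaw n)

/-- The expected losses at `z_k` of the first `T` iterates, summed with the step sizes as weights;
both the risk and the stability of the average are controlled by it. -/
noncomputable def expCumLoss (Ω : Set (Param d)) (f : Param d → Z → ℝ) (η : ℕ → ℝ) (T : ℕ)
    (S : Fin n → Z) (k : Fin n) : ℝ :=
  ∑ t ∈ Finset.range T, η t * expLoss Ω f η t S k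

namespace IsSmoothConvexLoss

theorem expLoss_nonneg (hf : IsSmoothConvexLoss L f) (t : ℕ) (S : Fin n → Z) (k : Fin n) :
    0 ≤ expLoss Ω f η t S k :=
  integral_nonneg fun _ => hf.nonneg _ _

theorem inv_mul_sum_expCumLoss_le (hL : 0 < L) (hΩ : IsFeasibleSet Ω)
    (hf : IsSmoothConvexLoss L f) (hη : ∀ t, 0 ≤ η t) (hηM : ∀ t, η t ≤ M) (hLM : L * M ≤ 1 / 2)
    {u : Param d} (hu : u ∈ Ω) (T : ℕ) (S : Fin n → Z) :
    (n : ℝ)⁻¹ * ∑ k, expCumLoss Ω f η T S k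
      ≤ (1 + 2 * L * M)
        * (‖u‖ ^ 2 / 2 + (∑ t ∈ Finset.range T, η t) * ((n : ℝ)⁻¹ * ∑ k, f u (S k))) := by
  have hdep (t : ℕ) (k : Fin n) :
      DependsOn (fun i => f (sgd Ω f η S i t) (S k)) (Finset.range t) :=
    fun _ _ hij => congrArg (fun w => f w (S k)) (dependsOn_sgd Ω f η S t hij)
  have hint (t : ℕ) : Integrable (fun i => η t * f (sgd Ω f η S i t) (S (i t))) (indexLaw n) :=
    (integrable_indexLaw_eval (hdep t)).const_mul _
  have hintu (t : ℕ) : Integrable (fun i => η t * f u (S (i t))) (indexLaw n) :=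
    (integrable_indexLaw_eval (t := t) fun k => (fun _ _ _ => rfl :
      DependsOn (fun _ : ℕ → Fin n => f u (S k)) (Finset.range t))).const_mul _
  have hmean (t : ℕ) : ∫ i, f u (S (i t)) ∂(indexLaw n) = (n : ℝ)⁻¹ * ∑ k, f u (S k) := by
    rw [integral_indexLaw_eval (H := fun _ k => f u (S k)) fun k _ _ _ => rfl]
    simp
  calc (n : ℝ)⁻¹ * ∑ k, expCumLoss Ω f η T S k
    _ = ∫ i, ∑ t ∈ Finset.range T, η t * f (sgd Ω f η S i t) (S (i t)) ∂(indexLaw n) := by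
      rw [integral_finsetSum _ fun t _ => hint t]
      simp only [integral_const_mul, integral_indexLaw_eval (hdep _), expCumLoss]
      rw [Finset.sum_comm, Finset.mul_sum]
      simp only [Finset.mul_sum, mul_left_comm, expLoss]
    _ ≤ ∫ i, (1 + 2 * L * M) * (‖u‖ ^ 2 / 2 + ∑ t ∈ Finset.range T, η t * f u (S (i t)))
          ∂(indexLaw n) :=
      integral_mono (integrable_finsetSum _ fun t _ => hint t)
        (((integrable_const _).add (integrable_finsetSum _ fun t _ => hintu t)).const_mul _)
        fun i => hf.sum_mul_loss_sgd_le hL hΩ hη hηM hLM hu S i T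
    _ = _ := by
      rw [integral_const_mul, integral_add (integrable_const _)
        (integrable_finsetSum _ fun t _ => hintu t), integral_finsetSum _ fun t _ => hintu t]
      simp only [integral_const_mul, hmean, integral_const, probReal_univ, one_smul,
        ← Finset.sum_mul]

theorem integral_sq_norm_sgd_succ_sub_le (hL : 0 < L) (hΩ : IsFeasibleSet Ω)
    (hf : IsSmoothConvexLoss L f) (hη : ∀ t, 0 ≤ η t) (hLη : ∀ t, L * η t ≤ 2) {p : ℝ}
    (hp : 0 < p) (hS : ∀ j, j ≠ k → S j = S' j) (t : ℕ) :
    ∫ i, ‖sgd Ω f η S i (t + 1) - sgd Ω f η S' i (t + 1)‖ ^ 2 ∂(indexLaw n)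
      ≤ (1 + p / n) * ∫ i, ‖sgd Ω f η S i t - sgd Ω f η S' i t‖ ^ 2 ∂(indexLaw n)
        + (1 + p⁻¹) / n * (4 * L * η t ^ 2 * (expLoss Ω f η t S k + expLoss Ω f η t S' k)) := by
  let H : (ℕ → Fin n) → Fin n → ℝ := fun i j =>
    if j = k then p * ‖sgd Ω f η S i t - sgd Ω f η S' i t‖ ^ 2
      + (1 + p⁻¹) * (4 * L * η t ^ 2
        * (f (sgd Ω f η S i t) (S k) + f (sgd Ω f η S' i t) (S' k)))
    else 0
  have hH (j : Fin n) : DependsOn (fun i => H i j) (Finset.range t) := fun i i' hij => by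
    simp only [H, dependsOn_sgd Ω f η S t hij, dependsOn_sgd Ω f η S' t hij]
  have hdist (s : ℕ) := integrable_comp_sgd_sgd (n := n) (Ω := Ω) (f := f)
    (fun w v => ‖w - v‖ ^ 2) η S S' s
  have hloss := integrable_comp_sgd (n := n) (Ω := Ω) (f := f) (fun w => f w (S k)) η S t
  have hloss' := integrable_comp_sgd (n := n) (Ω := Ω) (f := f) (fun w => f w (S' k)) η S' t
  have hlosses : Integrable (fun i => f (sgd Ω f η S i t) (S k) + f (sgd Ω f η S' i t) (S' k))
      (indexLaw n) := hloss.add hloss'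
  have hHk : ∫ i, H i k ∂(indexLaw n)
      = p * ∫ i, ‖sgd Ω f η S i t - sgd Ω f η S' i t‖ ^ 2 ∂(indexLaw n)
        + (1 + p⁻¹) * (4 * L * η t ^ 2 * (expLoss Ω f η t S k + expLoss Ω f η t S' k)) := by
    simp only [H, if_true]
    rw [integral_add ((hdist t).const_mul _) (hlosses.const_mul _ |>.const_mul _),
      integral_const_mul, integral_const_mul, integral_const_mul, integral_add hloss hloss',
      expLoss, expLoss]
  have hsum : ∑ j, ∫ i, H i j ∂(indexLaw n) = ∫ i, H i k ∂(indexLaw n) :=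
    Finset.sum_eq_single k (fun j _ hj => by simp [H, hj]) (by simp)
  have hmono := integral_mono (hdist (t + 1)) ((hdist t).add (integrable_indexLaw_eval hH))
    fun i => hf.sq_norm_sgd_succ_sub_le hL hΩ hη hLη hp hS i t
  simp only [Pi.add_apply] at hmono
  rw [integral_add (hdist t) (integrable_indexLaw_eval hH), integral_indexLaw_eval hH, hsum,
    hHk] at hmono
  refine hmono.trans_eq ?_
  ring

theorem integral_sq_norm_sgd_sub_le (hL : 0 < L) (hΩ : IsFeasibleSet Ω)
    (hf : IsSmoothConvexLoss L f) (hη : ∀ t, 0 ≤ η t) (hηM : ∀ t, η t ≤ M) (hLM : L * M ≤ 2)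
    (hS : ∀ j, j ≠ k → S j = S' j) {t : ℕ} (htT : t ≤ T) (hT : 0 < T) :
    ∫ i, ‖sgd Ω f η S i t - sgd Ω f η S' i t‖ ^ 2 ∂(indexLaw n)
      ≤ 12 * L * M * (1 + T / n) / n
        * (expCumLoss Ω f η T S k + expCumLoss Ω f η T S' k) := by
  have hn : (0 : ℝ) < n := Nat.cast_pos.2 (NeZero.pos n)
  have hT' : (0 : ℝ) < T := Nat.cast_pos.2 hT
  have hM : 0 ≤ M := (hη 0).trans (hηM 0)
  set K := 4 * L * M * (1 + T / n) / n with hK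
  have hloss (s : ℕ) : 0 ≤ η s * (expLoss Ω f η s S k + expLoss Ω f η s S' k) :=
    mul_nonneg (hη s) (add_nonneg (hf.expLoss_nonneg _ _ _) (hf.expLoss_nonneg _ _ _))
  have hstep (s : ℕ) : ∫ i, ‖sgd Ω f η S i (s + 1) - sgd Ω f η S' i (s + 1)‖ ^ 2 ∂(indexLaw n)
      ≤ (1 + (T : ℝ)⁻¹) * ∫ i, ‖sgd Ω f η S i s - sgd Ω f η S' i s‖ ^ 2 ∂(indexLaw n)
        + K * (η s * (expLoss Ω f η s S k + expLoss Ω f η s S' k)) := by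
    refine (hf.integral_sq_norm_sgd_succ_sub_le hL hΩ hη
      (fun r => (mul_le_mul_of_nonneg_left (hηM r) hL.le).trans hLM)
      (div_pos hn hT') hS s).trans ?_
    rw [div_div_cancel_left' hn.ne', inv_div]
    refine add_le_add_right ?_ _
    calc (1 + T / n) / n * (4 * L * η s ^ 2 * (expLoss Ω f η s S k + expLoss Ω f η s S' k))
      _ = 4 * L * (1 + T / n) / n
            * (η s * (η s * (expLoss Ω f η s S k + expLoss Ω f η s S' k))) := by ring
      _ ≤ 4 * L * (1 + T / n) / n
            * (M * (η s * (expLoss Ω f η s S k + expLoss Ω f η s S' k))) := by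
        gcongr
        · exact hloss s
        · exact hηM s
      _ = K * (η s * (expLoss Ω f η s S k + expLoss Ω f η s S' k)) := by rw [hK]; ring
  refine (le_three_mul_sum_of_succ_le
    (x := fun s => ∫ i, ‖sgd Ω f η S i s - sgd Ω f η S' i s‖ ^ 2 ∂(indexLaw n)) hT
    (by simp [sgd]) (fun s => mul_nonneg (by positivity) (hloss s)) hstep htT).trans_eq ?_
  simp only [expCumLoss, hK, mul_add, Finset.sum_add_distrib, Finset.mul_sum]
  ring_nf

theorem integral_sq_norm_sgdAverage_sub_le (hL : 0 < L) (hΩ : IsFeasibleSet Ω)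
    (hf : IsSmoothConvexLoss L f) (hη : ∀ t, 0 ≤ η t) (hηM : ∀ t, η t ≤ M) (hLM : L * M ≤ 2)
    (hsum : 0 < ∑ t ∈ Finset.range T, η t) (hS : ∀ j, j ≠ k → S j = S' j) :
    ∫ i, ‖sgdAverage Ω f η S i T - sgdAverage Ω f η S' i T‖ ^ 2 ∂(indexLaw n)
      ≤ 12 * L * M * (1 + T / n) / n
        * (expCumLoss Ω f η T S k + expCumLoss Ω f η T S' k) := by
  have hdist (t : ℕ) : Integrable (fun i => ‖sgd Ω f η S i t - sgd Ω f η S' i t‖ ^ 2)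
      (indexLaw n) :=
    integrable_comp_sgd_sgd (fun w v => ‖w - v‖ ^ 2) η S S' t
  have hmono := integral_mono
    (integrable_comp_sgdAverage_sgdAverage (fun w v => ‖w - v‖ ^ 2) η S S' T)
    (integrable_centerMass fun t => hdist t)
    fun i => sq_norm_centerMass_sub_centerMass_le (fun t _ => hη t) hsum (sgd Ω f η S i)
      (sgd Ω f η S' i)
  rw [integral_centerMass fun t => hdist t] at hmono
  refine hmono.trans (centerMass_le_of_forall_le (fun t _ => hη t) hsum fun t ht => ?_)
  have htT := Finset.mem_range.1 ht
  exact hf.integral_sq_norm_sgd_sub_le hL hΩ hη hηM hLM hS htT.le (t.zero_le.trans_lt htT)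

theorem integral_loss_sgdAverage_le (hf : IsSmoothConvexLoss L f) (hη : ∀ t, 0 ≤ η t)
    (hsum : 0 < ∑ t ∈ Finset.range T, η t) (S : Fin n → Z) (k : Fin n) :
    ∫ i, f (sgdAverage Ω f η S i T) (S k) ∂(indexLaw n)
      ≤ (∑ t ∈ Finset.range T, η t)⁻¹ * expCumLoss Ω f η T S k := by
  have hloss (t : ℕ) : Integrable (fun i => f (sgd Ω f η S i t) (S k)) (indexLaw n) :=
    integrable_comp_sgd (fun w => f w (S k)) η S t
  have hmono := integral_mono (integrable_comp_sgdAverage (fun w => f w (S k)) η S T)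
    (integrable_centerMass fun t => hloss t)
    fun i => (hf.convex (S k)).map_centerMass_le (p := sgd Ω f η S i) (fun t _ => hη t) hsum
      fun _ _ => Set.mem_univ _
  exact hmono.trans_eq (integral_centerMass fun t => hloss t)

theorem integral_loss_sgdAverage_perturbed_le (hL : 0 < L) (hΩ : IsFeasibleSet Ω)
    (hf : IsSmoothConvexLoss L f) (hη : ∀ t, 0 ≤ η t) (hηM : ∀ t, η t ≤ M) (hLM : L * M ≤ 2)
    {γ : ℝ} (hγ : 0 < γ) (hsum : 0 < ∑ t ∈ Finset.range T, η t)
    (hS : ∀ j, j ≠ k → S j = S' j) :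
    ∫ i, f (sgdAverage Ω f η S' i T) (S k) ∂(indexLaw n)
      ≤ (1 + L / γ) * ((∑ t ∈ Finset.range T, η t)⁻¹ * expCumLoss Ω f η T S k)
        + (L + γ) / 2 * (12 * L * M * (1 + T / n) / n
          * (expCumLoss Ω f η T S k + expCumLoss Ω f η T S' k)) := by
  have hloss := integrable_comp_sgdAverage (n := n) (Ω := Ω) (f := f)
    (fun w => f w (S k)) η S T
  have hdist := integrable_comp_sgdAverage_sgdAverage (n := n) (Ω := Ω) (f := f)
    (fun w v => ‖v - w‖ ^ 2) η S S' T
  have hmono := integral_mono (integrable_comp_sgdAverage (fun w => f w (S k)) η S' T)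
    ((hloss.const_mul (1 + L / γ)).add (hdist.const_mul ((L + γ) / 2)))
    fun i => (hf.isSmoothWith (S k)).le_mul_add_sq_norm_sub hL hγ (fun w => hf.nonneg w _)
      (sgdAverage Ω f η S' i T) (sgdAverage Ω f η S i T)
  rw [integral_add' (hloss.const_mul _) (hdist.const_mul _), integral_const_mul,
    integral_const_mul] at hmono
  refine hmono.trans ?_
  simp only [norm_sub_rev (sgdAverage Ω f η S' _ T)]
  gcongr
  · exact hf.integral_loss_sgdAverage_le hη hsum S k
  · exact hf.integral_sq_norm_sgdAverage_sub_le hL hΩ hη hηM hLM hsum hS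

end IsSmoothConvexLoss

end FixedSample

section RandomSample

theorem measurePreserving_prod_right_comm {α β γ : Type*} [MeasurableSpace α] [MeasurableSpace β]
    [MeasurableSpace γ] (μ : Measure α) (ν : Measure β) (τ : Measure γ) [SFinite μ] [SFinite ν]
    [SFinite τ] :
    MeasurePreserving (fun r : (α × γ) × β => ((r.1.1, r.2), r.1.2)) ((μ.prod τ).prod ν)
      ((μ.prod ν).prod τ) :=
  ((measurePreserving_prodAssoc μ ν τ).symm).comp
    (((MeasurePreserving.id μ).prod Measure.measurePreserving_swap).comp
      (measurePreserving_prodAssoc μ τ ν))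

variable {d n : ℕ} {Z : Type*} [MeasurableSpace Z] {ρ : Measure Z} {L M : ℝ} {Ω : Set (Param d)}
  {f : Param d → Z → ℝ} {η : ℕ → ℝ} {u : Param d} {T : ℕ}

/-- The law of the sample: `n` independent draws from `ρ`. -/
noncomputable abbrev sampleLaw (ρ : Measure Z) (n : ℕ) : Measure (Fin n → Z) :=
  Measure.pi fun _ => ρ

instance [IsProbabilityMeasure ρ] [NeZero n] : IsProbabilityMeasure (sampleIndexLaw ρ n) :=
  inferInstanceAs (IsProbabilityMeasure ((sampleLaw ρ n).prod (indexLaw n)))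

theorem integrable_sqRadius [IsFiniteMeasure ρ] (hu : Integrable (f u) ρ) (η : ℕ → ℝ)
    (T : ℕ) : Integrable (sqRadius f η u T) (sampleLaw ρ n) :=
  (integrable_const _).add ((integrable_finsetSum _ fun _ _ => integrable_comp_eval hu).const_mul _)

namespace IsSmoothConvexLoss

theorem integrable_loss_of_sq_norm_sub_le (hL : 0 < L) (hf : IsSmoothConvexLoss L f)
    (hm : ∀ w, Measurable (f w)) {α : Type*} [MeasurableSpace α] {μ : Measure α}
    {w : α → Param d} {ζ : α → Z} {B : α → ℝ} (hw : Measurable w) (hζ : Measurable ζ)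
    (hu : Integrable (fun x => f u (ζ x)) μ) (hB : Integrable B μ)
    (hwB : ∀ x, ‖w x - u‖ ^ 2 ≤ B x) : Integrable (fun x => f (w x) (ζ x)) μ := by
  refine ((hu.const_mul 2).add (hB.const_mul L)).mono'
    ((hf.measurable_uncurry hm).comp (hw.prodMk hζ)).aestronglyMeasurable
    (Filter.Eventually.of_forall fun x => ?_)
  rw [Real.norm_of_nonneg (hf.nonneg _ _)]
  exact hf.loss_le_of_sq_norm_sub_le hL (hwB x) (ζ x)

theorem popRisk_nonneg (hf : IsSmoothConvexLoss L f) (ρ : Measure Z) (w : Param d) :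
    0 ≤ popRisk ρ f w :=
  integral_nonneg fun z => hf.nonneg w z

variable [IsProbabilityMeasure ρ] [NeZero n]

theorem integrable_expLoss (hL : 0 < L) (hΩ : IsFeasibleSet Ω) (hf : IsSmoothConvexLoss L f)
    (hm : ∀ w, Measurable (f w)) (hi : ∀ w, Integrable (f w) ρ) (hη : ∀ t, 0 ≤ η t)
    (hLη : ∀ t, L * η t ≤ 1) (t : ℕ) (k : Fin n) :
    Integrable (fun S => expLoss Ω f η t S k) (sampleLaw ρ n) := by
  obtain ⟨u, hu⟩ := hΩ.nonempty
  have hloss : Integrable (fun p : (Fin n → Z) × (ℕ → Fin n) => f (sgd Ω f η p.1 p.2 t) (p.1 k))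
      ((sampleLaw ρ n).prod (indexLaw n)) :=
    hf.integrable_loss_of_sq_norm_sub_le hL hm (hf.measurable_sgd hΩ hm η t)
      ((measurable_pi_apply k).comp measurable_fst)
      ((integrable_comp_eval (hi u)).comp_fst _) ((integrable_sqRadius (hi u) η t).comp_fst _)
      fun p => hf.sq_norm_sgd_sub_le hL hΩ hη hLη hu p.1 p.2 t
  exact hloss.integral_prod_left

theorem integrable_expCumLoss (hL : 0 < L) (hΩ : IsFeasibleSet Ω) (hf : IsSmoothConvexLoss L f)
    (hm : ∀ w, Measurable (f w)) (hi : ∀ w, Integrable (f w) ρ) (hη : ∀ t, 0 ≤ η t)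
    (hLη : ∀ t, L * η t ≤ 1) (T : ℕ) (k : Fin n) :
    Integrable (fun S => expCumLoss Ω f η T S k) (sampleLaw ρ n) :=
  integrable_finsetSum _ fun t _ =>
    (hf.integrable_expLoss hL hΩ hm hi hη hLη t k).const_mul (η t)

theorem inv_mul_sum_integral_expCumLoss_le (hL : 0 < L) (hΩ : IsFeasibleSet Ω)
    (hf : IsSmoothConvexLoss L f) (hm : ∀ w, Measurable (f w)) (hi : ∀ w, Integrable (f w) ρ)
    (hη : ∀ t, 0 ≤ η t) (hηM : ∀ t, η t ≤ M) (hLM : L * M ≤ 1 / 2) (hu : u ∈ Ω) (T : ℕ) :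
    (n : ℝ)⁻¹ * ∑ k, ∫ S, expCumLoss Ω f η T S k ∂(sampleLaw ρ n)
      ≤ (1 + 2 * L * M) * (‖u‖ ^ 2 / 2 + (∑ t ∈ Finset.range T, η t) * popRisk ρ f u) := by
  have hLη (t : ℕ) : L * η t ≤ 1 := by linarith [mul_le_mul_of_nonneg_left (hηM t) hL.le]
  have hcum (k : Fin n) := hf.integrable_expCumLoss hL hΩ hm hi hη hLη T k
  have heval (k : Fin n) : Integrable (fun S : Fin n → Z => f u (S k)) (sampleLaw ρ n) :=
    integrable_comp_eval (hi u)
  have hmean : Integrable (fun S : Fin n → Z => (∑ t ∈ Finset.range T, η t)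
      * ((n : ℝ)⁻¹ * ∑ k, f u (S k))) (sampleLaw ρ n) :=
    ((integrable_finsetSum _ fun k _ => heval k).const_mul _).const_mul _
  have hemp : ∫ S : Fin n → Z, (n : ℝ)⁻¹ * ∑ k, f u (S k) ∂(sampleLaw ρ n) = popRisk ρ f u := by
    rw [integral_const_mul, integral_finsetSum _ fun k _ => heval k]
    have hmarginal (k : Fin n) : ∫ S, f u (S k) ∂(sampleLaw ρ n) = popRisk ρ f u :=
      integral_comp_eval (μ := fun _ => ρ) (hi u).aestronglyMeasurable
    simp only [hmarginal, Finset.sum_const, Finset.card_univ, Fintype.card_fin, nsmul_eq_mul]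
    exact inv_mul_cancel_left₀ (Nat.cast_ne_zero.2 (NeZero.ne n)) _
  rw [← integral_finsetSum _ fun k _ => hcum k, ← integral_const_mul]
  refine (integral_mono ((integrable_finsetSum _ fun k _ => hcum k).const_mul _)
    (((integrable_const _).add hmean).const_mul _)
    fun S => hf.inv_mul_sum_expCumLoss_le hL hΩ hη hηM hLM hu T S).trans_eq ?_
  rw [integral_const_mul, integral_add' (integrable_const _) hmean, integral_const_mul, hemp]
  simp

theorem integrable_loss_sgdAverage (hL : 0 < L) (hΩ : IsFeasibleSet Ω)
    (hf : IsSmoothConvexLoss L f) (hm : ∀ w, Measurable (f w)) (hi : ∀ w, Integrable (f w) ρ)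
    (hη : ∀ t, 0 ≤ η t) (hLη : ∀ t, L * η t ≤ 1) (hsum : 0 < ∑ t ∈ Finset.range T, η t) :
    Integrable (fun r : ((Fin n → Z) × (ℕ → Fin n)) × Z =>
      f (sgdAverage Ω f η r.1.1 r.1.2 T) r.2) ((sampleIndexLaw ρ n).prod ρ) := by
  obtain ⟨u, hu⟩ := hΩ.nonempty
  have hradius : Integrable (fun p : (Fin n → Z) × (ℕ → Fin n) => sqRadius f η u T p.1)
      (sampleIndexLaw ρ n) := (integrable_sqRadius (hi u) η T).comp_fst _
  exact hf.integrable_loss_of_sq_norm_sub_le hL hm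
    ((hf.measurable_sgdAverage hΩ hm η T).comp measurable_fst) measurable_snd
    ((hi u).comp_snd _) (hradius.comp_fst ρ)
    fun r => hf.sq_norm_sgdAverage_sub_le hL hΩ hη hLη hsum hu r.1.1 r.1.2

theorem integrable_popRisk_sgdAverage (hL : 0 < L) (hΩ : IsFeasibleSet Ω)
    (hf : IsSmoothConvexLoss L f) (hm : ∀ w, Measurable (f w)) (hi : ∀ w, Integrable (f w) ρ)
    (hη : ∀ t, 0 ≤ η t) (hLη : ∀ t, L * η t ≤ 1) (hsum : 0 < ∑ t ∈ Finset.range T, η t) :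
    Integrable (fun p => popRisk ρ f (sgdAverage Ω f η p.1 p.2 T)) (sampleIndexLaw ρ n) :=
  (hf.integrable_loss_sgdAverage hL hΩ hm hi hη hLη hsum).integral_prod_left

theorem integrable_integral_loss_sgdAverage (hL : 0 < L) (hΩ : IsFeasibleSet Ω)
    (hf : IsSmoothConvexLoss L f) (hm : ∀ w, Measurable (f w)) (hi : ∀ w, Integrable (f w) ρ)
    (hη : ∀ t, 0 ≤ η t) (hLη : ∀ t, L * η t ≤ 1) (hsum : 0 < ∑ t ∈ Finset.range T, η t) :
    Integrable (fun q : (Fin n → Z) × Z => ∫ i, f (sgdAverage Ω f η q.1 i T) q.2 ∂(indexLaw n))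
      ((sampleLaw ρ n).prod ρ) :=
  ((measurePreserving_prod_right_comm (sampleLaw ρ n) (indexLaw n) ρ).integrable_comp_of_integrable
    (hf.integrable_loss_sgdAverage hL hΩ hm hi hη hLη hsum)).integral_prod_left

theorem integral_popRisk_sgdAverage_eq (hL : 0 < L) (hΩ : IsFeasibleSet Ω)
    (hf : IsSmoothConvexLoss L f) (hm : ∀ w, Measurable (f w)) (hi : ∀ w, Integrable (f w) ρ)
    (hη : ∀ t, 0 ≤ η t) (hLη : ∀ t, L * η t ≤ 1) (hsum : 0 < ∑ t ∈ Finset.range T, η t)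
    (k : Fin n) :
    ∫ p, popRisk ρ f (sgdAverage Ω f η p.1 p.2 T) ∂(sampleIndexLaw ρ n)
      = ∫ q : (Fin n → Z) × Z, ∫ i, f (sgdAverage Ω f η (exchange k q).1 i T) (exchange k q).2
          ∂(indexLaw n) ∂((sampleLaw ρ n).prod ρ) := by
  have hloss := hf.integrable_loss_sgdAverage (n := n) hL hΩ hm hi hη hLη hsum
  have hcomm := measurePreserving_prod_right_comm (sampleLaw ρ n) (indexLaw n) ρ
  calc ∫ p, popRisk ρ f (sgdAverage Ω f η p.1 p.2 T) ∂(sampleIndexLaw ρ n)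
    _ = ∫ r : ((Fin n → Z) × (ℕ → Fin n)) × Z, f (sgdAverage Ω f η r.1.1 r.1.2 T) r.2
          ∂((sampleIndexLaw ρ n).prod ρ) := (integral_prod _ hloss).symm
    _ = ∫ r : ((Fin n → Z) × Z) × (ℕ → Fin n), f (sgdAverage Ω f η r.1.1 r.2 T) r.1.2
          ∂(((sampleLaw ρ n).prod ρ).prod (indexLaw n)) :=
      (hcomm.hasLaw.integral_comp hloss.aestronglyMeasurable).symm
    _ = ∫ q : (Fin n → Z) × Z, ∫ i, f (sgdAverage Ω f η q.1 i T) q.2 ∂(indexLaw n)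
          ∂((sampleLaw ρ n).prod ρ) :=
      integral_prod _ (hcomm.integrable_comp_of_integrable hloss)
    _ = _ := ((measurePreserving_exchange ρ k).integral_comp' fun q : (Fin n → Z) × Z =>
      ∫ i, f (sgdAverage Ω f η q.1 i T) q.2 ∂(indexLaw n)).symm

theorem integral_popRisk_sgdAverage_le_integral_expCumLoss (hL : 0 < L) (hΩ : IsFeasibleSet Ω)
    (hf : IsSmoothConvexLoss L f) (hm : ∀ w, Measurable (f w)) (hi : ∀ w, Integrable (f w) ρ)
    (hη : ∀ t, 0 ≤ η t) (hηM : ∀ t, η t ≤ M) (hLM : L * M ≤ 1)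
    (hsum : 0 < ∑ t ∈ Finset.range T, η t) {γ : ℝ} (hγ : 0 < γ) (k : Fin n) :
    ∫ p, popRisk ρ f (sgdAverage Ω f η p.1 p.2 T) ∂(sampleIndexLaw ρ n)
      ≤ ((1 + L / γ) * (∑ t ∈ Finset.range T, η t)⁻¹
          + (L + γ) * (12 * L * M * (1 + T / n) / n))
        * ∫ S, expCumLoss Ω f η T S k ∂(sampleLaw ρ n) := by
  have hLη (t : ℕ) : L * η t ≤ 1 := (mul_le_mul_of_nonneg_left (hηM t) hL.le).trans hLM
  have hexch := measurePreserving_exchange ρ k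
  have hcum : Integrable (fun q : (Fin n → Z) × Z => expCumLoss Ω f η T q.1 k)
      ((sampleLaw ρ n).prod ρ) :=
    (hf.integrable_expCumLoss hL hΩ hm hi hη hLη T k).comp_fst ρ
  have hcum' : Integrable (fun q => expCumLoss Ω f η T (exchange k q).1 k)
      ((sampleLaw ρ n).prod ρ) := hexch.integrable_comp_of_integrable hcum
  have hfst : ∫ q : (Fin n → Z) × Z, expCumLoss Ω f η T q.1 k ∂((sampleLaw ρ n).prod ρ)
      = ∫ S, expCumLoss Ω f η T S k ∂(sampleLaw ρ n) := by
    simpa using integral_fun_fst (μ := sampleLaw ρ n) (ν := ρ) fun S => expCumLoss Ω f η T S k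
  have hfst' : ∫ q, expCumLoss Ω f η T (exchange k q).1 k ∂((sampleLaw ρ n).prod ρ)
      = ∫ S, expCumLoss Ω f η T S k ∂(sampleLaw ρ n) :=
    (hexch.integral_comp' fun q => expCumLoss Ω f η T q.1 k).trans hfst
  have hA := (hcum.const_mul (∑ t ∈ Finset.range T, η t)⁻¹).const_mul (1 + L / γ)
  have hB := ((hcum.add hcum').const_mul (12 * L * M * (1 + T / n) / n)).const_mul ((L + γ) / 2)
  rw [hf.integral_popRisk_sgdAverage_eq hL hΩ hm hi hη hLη hsum k]
  refine (integral_mono (hexch.integrable_comp_of_integrable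
    (hf.integrable_integral_loss_sgdAverage hL hΩ hm hi hη hLη hsum)) (hA.add hB)
    fun q => hf.integral_loss_sgdAverage_perturbed_le hL hΩ hη hηM (hLM.trans one_le_two) hγ hsum
      fun j hj => (Function.update_of_ne hj _ _).symm).trans_eq ?_
  rw [integral_add' hA hB, integral_const_mul, integral_const_mul, integral_const_mul,
    integral_const_mul, integral_add' hcum hcum', hfst, hfst']
  ring

theorem integral_popRisk_sgdAverage_le (hL : 0 < L) (hΩ : IsFeasibleSet Ω)
    (hf : IsSmoothConvexLoss L f) (hm : ∀ w, Measurable (f w)) (hi : ∀ w, Integrable (f w) ρ)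
    (hη : ∀ t, 0 ≤ η t) (hηM : ∀ t, η t ≤ M) (hLM : L * M ≤ 1 / 2)
    (hsum : 0 < ∑ t ∈ Finset.range T, η t) {γ : ℝ} (hγ : 0 < γ) (hu : u ∈ Ω) :
    ∫ p, popRisk ρ f (sgdAverage Ω f η p.1 p.2 T) ∂(sampleIndexLaw ρ n)
      ≤ ((1 + L / γ) * (∑ t ∈ Finset.range T, η t)⁻¹
          + (L + γ) * (12 * L * M * (1 + T / n) / n))
        * ((1 + 2 * L * M)
          * (‖u‖ ^ 2 / 2 + (∑ t ∈ Finset.range T, η t) * popRisk ρ f u)) := by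
  have hM : 0 ≤ M := (hη 0).trans (hηM 0)
  set A := (1 + L / γ) * (∑ t ∈ Finset.range T, η t)⁻¹ + (L + γ) * (12 * L * M * (1 + T / n) / n)
  have hA : 0 ≤ A := by positivity
  have hn : (n : ℝ) ≠ 0 := Nat.cast_ne_zero.2 (NeZero.ne n)
  calc ∫ p, popRisk ρ f (sgdAverage Ω f η p.1 p.2 T) ∂(sampleIndexLaw ρ n)
    _ = (n : ℝ)⁻¹ * ∑ _k : Fin n,
          ∫ p, popRisk ρ f (sgdAverage Ω f η p.1 p.2 T) ∂(sampleIndexLaw ρ n) := by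
      simp [hn]
    _ ≤ (n : ℝ)⁻¹ * ∑ k : Fin n, A * ∫ S, expCumLoss Ω f η T S k ∂(sampleLaw ρ n) := by
      gcongr with k
      exact hf.integral_popRisk_sgdAverage_le_integral_expCumLoss hL hΩ hm hi hη hηM
        (by linarith) hsum hγ k
    _ = A * ((n : ℝ)⁻¹ * ∑ k : Fin n, ∫ S, expCumLoss Ω f η T S k ∂(sampleLaw ρ n)) := by
      rw [← Finset.mul_sum, mul_left_comm]
    _ ≤ _ := mul_le_mul_of_nonneg_left
      (hf.inv_mul_sum_integral_expCumLoss_le hL hΩ hm hi hη hηM hLM hu T) hA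

end IsSmoothConvexLoss

end RandomSample

section LowerBound

variable {d n : ℕ} {Z : Type*} {L : ℝ} {Ω : Set (Param d)} {f : Param d → Z → ℝ} {η : ℕ → ℝ}
  {u : Param d} {T : ℕ}

-- The average of the path in which the initial point `0` is replaced by `u`.
theorem sgdAverage_add_smul_mem (hΩ : IsFeasibleSet Ω) (hη : ∀ t, 0 ≤ η t)
    (hsum : 0 < ∑ t ∈ Finset.range T, η t) (hu : u ∈ Ω) (S : Fin n → Z) (i : ℕ → Fin n) :
    sgdAverage Ω f η S i T + (η 0 / ∑ t ∈ Finset.range T, η t) • u ∈ Ω := by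
  let x : ℕ → Param d := fun t => sgd Ω f η S i t + if t = 0 then u else 0
  have hT : T ≠ 0 := by
    rintro rfl
    simp at hsum
  have hx (t : ℕ) : x t ∈ Ω := by
    cases t with
    | zero => simpa [x, sgd] using hu
    | succ t => simpa [x, sgd] using hΩ.projOn_mem _
  have hmem : (Finset.range T).centerMass η x ∈ Ω :=
    hΩ.convex.centerMass_mem (fun t _ => hη t) hsum fun t _ => hx t
  convert hmem using 1
  simp [x, sgdAverage, Finset.centerMass, Finset.sum_add_distrib, smul_smul, hT, div_eq_inv_mul]

variable [MeasurableSpace Z] {ρ : Measure Z} [IsProbabilityMeasure ρ]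

namespace IsSmoothConvexLoss

theorem popRisk_add_smul_le {r : ℝ} (hL : 0 < L) (hf : IsSmoothConvexLoss L f)
    (hi : ∀ w, Integrable (f w) ρ) (hr : 0 ≤ r) (hr1 : r ≤ 1) (w u : Param d) :
    popRisk ρ f (w + r • u) ≤ (1 + r) * popRisk ρ f w + r * (L * ‖u‖ ^ 2) := by
  have hint := integral_mono (hi (w + r • u)) (((hi w).const_mul (1 + r)).add (integrable_const _))
    fun z => (hf.isSmoothWith z).apply_add_smul_le hL (fun w => hf.nonneg w z) hr hr1 w u
  rwa [integral_add' ((hi w).const_mul _) (integrable_const _), integral_const_mul,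
    integral_const, probReal_univ, one_smul] at hint

theorem popRisk_sub_le_popRisk_sgdAverage (hL : 0 < L) (hΩ : IsFeasibleSet Ω)
    (hf : IsSmoothConvexLoss L f) (hi : ∀ w, Integrable (f w) ρ) (hη : ∀ t, 0 ≤ η t)
    (hsum : 0 < ∑ t ∈ Finset.range T, η t) (hu : u ∈ Ω)
    (hmin : ∀ w ∈ Ω, popRisk ρ f u ≤ popRisk ρ f w) (S : Fin n → Z) (i : ℕ → Fin n) :
    popRisk ρ f u - η 0 / (∑ t ∈ Finset.range T, η t) * (popRisk ρ f u + L * ‖u‖ ^ 2)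
      ≤ popRisk ρ f (sgdAverage Ω f η S i T) := by
  set r := η 0 / ∑ t ∈ Finset.range T, η t
  set w := sgdAverage Ω f η S i T
  have hr : 0 ≤ r := div_nonneg (hη 0) hsum.le
  have hr1 : r ≤ 1 := by
    refine div_le_one_of_le₀ (Finset.single_le_sum (fun t _ => hη t) ?_) hsum.le
    rw [Finset.mem_range, Nat.pos_iff_ne_zero]
    rintro rfl
    simp at hsum
  have hle : popRisk ρ f u ≤ (1 + r) * popRisk ρ f w + r * (L * ‖u‖ ^ 2) :=
    (hmin _ (sgdAverage_add_smul_mem hΩ hη hsum hu S i)).trans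
      (hf.popRisk_add_smul_le hL hi hr hr1 w u)
  rcases le_total (popRisk ρ f u) (popRisk ρ f w) with huw | hwu
  · have hF := hf.popRisk_nonneg ρ u
    exact (sub_le_self _ (by positivity)).trans huw
  · linarith [mul_le_mul_of_nonneg_left hwu hr]

theorem popRisk_sub_le_integral_popRisk_sgdAverage [NeZero n] (hL : 0 < L)
    (hΩ : IsFeasibleSet Ω) (hf : IsSmoothConvexLoss L f) (hm : ∀ w, Measurable (f w))
    (hi : ∀ w, Integrable (f w) ρ) (hη : ∀ t, 0 ≤ η t) (hLη : ∀ t, L * η t ≤ 1)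
    (hsum : 0 < ∑ t ∈ Finset.range T, η t) (hu : u ∈ Ω)
    (hmin : ∀ w ∈ Ω, popRisk ρ f u ≤ popRisk ρ f w) :
    popRisk ρ f u - η 0 / (∑ t ∈ Finset.range T, η t) * (popRisk ρ f u + L * ‖u‖ ^ 2)
      ≤ ∫ p, popRisk ρ f (sgdAverage Ω f η p.1 p.2 T) ∂(sampleIndexLaw ρ n) := by
  simpa using integral_mono (integrable_const _)
    (hf.integrable_popRisk_sgdAverage (n := n) hL hΩ hm hi hη hLη hsum)
    fun p => hf.popRisk_sub_le_popRisk_sgdAverage hL hΩ hi hη hsum hu hmin p.1 p.2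

end IsSmoothConvexLoss

end LowerBound

section Rates

theorem pos_of_natCast_le_mul {n T : ℕ} [NeZero n] {b : ℝ} (hbT : (n : ℝ) ≤ b * T) : 0 < T := by
  refine Nat.pos_of_ne_zero fun hT => NeZero.ne n ?_
  simpa [hT] using hbT

theorem nonneg_of_natCast_le_mul {n T : ℕ} [NeZero n] {b : ℝ} (hbT : (n : ℝ) ≤ b * T) : 0 ≤ b :=
  nonneg_of_mul_nonneg_left (n.cast_nonneg.trans hbT) (Nat.cast_pos.2 (pos_of_natCast_le_mul hbT))

theorem inv_natCast_le_div_natCast {n T : ℕ} [NeZero n] {b : ℝ} (hbT : (n : ℝ) ≤ b * T) :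
    (T : ℝ)⁻¹ ≤ b / n := by
  have hn : (0 : ℝ) < n := Nat.cast_pos.2 (Nat.pos_of_neZero n)
  have hT : (0 : ℝ) < T := Nat.cast_pos.2 (pos_of_natCast_le_mul hbT)
  rwa [le_div_iff₀ hn, inv_mul_le_iff₀ hT, mul_comm]

theorem inv_sqrt_natCast_le_div_sqrt_natCast {n T : ℕ} [NeZero n] {b : ℝ}
    (hbT : (n : ℝ) ≤ b * T) : (√(T : ℝ))⁻¹ ≤ √b / √n := by
  rw [← Real.sqrt_inv, ← Real.sqrt_div' _ n.cast_nonneg]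
  exact Real.sqrt_le_sqrt (inv_natCast_le_div_natCast hbT)

theorem natCast_div_natCast_le_one_div {n T : ℕ} [NeZero n] {a : ℝ} (ha : 0 < a)
    (haT : a * T ≤ n) : (T : ℝ) / n ≤ 1 / a := by
  rwa [div_le_div_iff₀ (Nat.cast_pos.2 (Nat.pos_of_neZero n)) ha, one_mul, mul_comm]

theorem add_sqrt_div_natCast_le {n : ℕ} [NeZero n] {x : ℝ} (hx : 0 ≤ x) :
    (x + √n) / n ≤ (x + 1) * (√n)⁻¹ := by
  have hn : (1 : ℝ) ≤ √n := Real.one_le_sqrt.2 (Nat.one_le_cast.2 (Nat.pos_of_neZero n))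
  have : 0 < √(n : ℝ) := one_pos.trans_le hn
  calc (x + √n) / n
    _ = (x / √n + 1) * (√n)⁻¹ := by
      nth_rw 2 [← Real.mul_self_sqrt n.cast_nonneg]
      field
    _ ≤ (x + 1) * (√n)⁻¹ := by
      gcongr
      exact div_le_self hx hn

theorem stability_term_le_of_step_div_sqrt {n T : ℕ} [NeZero n] {L a : ℝ} (c : ℝ) (hL : 0 ≤ L)
    (ha : 0 < a) (haT : a * T ≤ n) (hT : 0 < T) :
    12 * L * (L + √n) / n * (T * (c / √T) ^ 2 * (1 + T / n))
      ≤ 12 * L * (L + 1) * (1 + 1 / a) * c ^ 2 * (√n)⁻¹ := by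
  have hratio := natCast_div_natCast_le_one_div ha haT
  have hTc : T * (c / √(T : ℝ)) ^ 2 = c ^ 2 := by
    rw [div_pow, Real.sq_sqrt T.cast_nonneg, mul_div_cancel₀ _ (Nat.cast_ne_zero.2 hT.ne')]
  calc 12 * L * (L + √n) / n * (T * (c / √T) ^ 2 * (1 + T / n))
    _ = 12 * L * ((L + √n) / n) * (1 + T / n) * c ^ 2 := by rw [hTc]; ring
    _ ≤ 12 * L * ((L + 1) * (√n)⁻¹) * (1 + 1 / a) * c ^ 2 := by
      gcongr
      exact add_sqrt_div_natCast_le hL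
    _ = 12 * L * (L + 1) * (1 + 1 / a) * c ^ 2 * (√n)⁻¹ := by ring

theorem one_add_mul_mul_add_mul_le {A B D F x : ℝ} (hA : 0 ≤ A) (hB : 0 ≤ B) (hD : 0 ≤ D)
    (hF : 0 ≤ F) (hx : 0 ≤ x) (hx1 : x ≤ 1) :
    (1 + A * x) * ((1 + D * x) * (F + B * x))
      ≤ F + (1 + A) * (1 + D) * (1 + B) * (F + 1) * x := by
  calc (1 + A * x) * ((1 + D * x) * (F + B * x))
    _ = F + (B * (1 + A * x) * (1 + D * x) + F * (A * (1 + D * x) + D)) * x := by ring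
    _ ≤ F + (B * (1 + A * 1) * (1 + D * 1) + F * (A * (1 + D * 1) + D)) * x := by gcongr
    _ ≤ F + (1 + A) * (1 + D) * (1 + B) * (F + 1) * x := by
      gcongr
      have : 0 ≤ (1 + A) * (1 + D) * (B * F) + (1 + A) * (1 + D) + F := by positivity
      linarith

/-- The constant of the rate `1 / √n` for the step size `c / √T`. Its two summands come from the
upper and from the lower bound of the excess risk. -/
noncomputable def rateConstant (L c R a b : ℝ) : ℝ :=
  (1 + (L + 12 * L * (L + 1) * (1 + 1 / a) * c ^ 2)) * (1 + 2 * L * c * √b)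
    * (1 + R ^ 2 * √b / (2 * c)) + b * (1 + L * R ^ 2)

/-- The constant of the rate `1 / n` in the low-noise case for the constant step size `η`. -/
noncomputable def lowNoiseRateConstant (L η R a b : ℝ) : ℝ :=
  (1 + L + 12 * L * (L + 1) * (1 + 1 / a) * η ^ 2 / a)
    * ((1 + 2 * L * η) * (R ^ 2 * b / (2 * η)))

variable {d n T : ℕ} {Z : Type*} [MeasurableSpace Z] {ρ : Measure Z} [IsProbabilityMeasure ρ]
  {L R a b c : ℝ} {Ω : Set (Param d)} {f : Param d → Z → ℝ} {u : Param d} [NeZero n]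

namespace IsSmoothConvexLoss

theorem integrable_popRisk_sgdAverage_of_const_step {η : ℝ} (hL : 0 < L) (hΩ : IsFeasibleSet Ω)
    (hf : IsSmoothConvexLoss L f) (hm : ∀ w, Measurable (f w)) (hi : ∀ w, Integrable (f w) ρ)
    (hη : 0 < η) (hLη : L * η ≤ 1) (hT : 0 < T) :
    Integrable (fun p => popRisk ρ f (sgdAverage Ω f (fun _ => η) p.1 p.2 T))
      (sampleIndexLaw ρ n) :=
  hf.integrable_popRisk_sgdAverage hL hΩ hm hi (fun _ => hη.le) (fun _ => hLη)
    (Finset.sum_pos (fun _ _ => hη) ⟨0, Finset.mem_range.2 hT⟩)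

theorem integral_popRisk_sgdAverage_le_of_const_step {η : ℝ} (hL : 0 < L)
    (hΩ : IsFeasibleSet Ω) (hf : IsSmoothConvexLoss L f) (hm : ∀ w, Measurable (f w))
    (hi : ∀ w, Integrable (f w) ρ) (hη : 0 < η) (hLη : L * η ≤ 1 / 2) (hT : 0 < T) {γ : ℝ}
    (hγ : 0 < γ) (hu : u ∈ Ω) :
    ∫ p, popRisk ρ f (sgdAverage Ω f (fun _ => η) p.1 p.2 T) ∂(sampleIndexLaw ρ n)
      ≤ (1 + L / γ + 12 * L * (L + γ) / n * (T * η ^ 2 * (1 + T / n)))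
        * ((1 + 2 * L * η) * (popRisk ρ f u + ‖u‖ ^ 2 / (2 * (T * η)))) := by
  have : (0 : ℝ) < T := Nat.cast_pos.2 hT
  have hsum : ∑ _t ∈ Finset.range T, η = T * η := by simp
  have hpos : 0 < ∑ _t ∈ Finset.range T, η :=
    Finset.sum_pos (fun _ _ => hη) ⟨0, Finset.mem_range.2 hT⟩
  have hle := hf.integral_popRisk_sgdAverage_le (n := n) (η := fun _ => η) hL hΩ hm hi
    (fun _ => hη.le) (fun _ => le_rfl) hLη hpos hγ hu
  rw [hsum] at hle
  refine hle.trans_eq ?_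
  have hn : (n : ℝ) ≠ 0 := Nat.cast_ne_zero.2 (NeZero.ne n)
  field

theorem popRisk_sub_le_integral_popRisk_sgdAverage_of_const_step {η : ℝ} (hL : 0 < L)
    (hΩ : IsFeasibleSet Ω) (hf : IsSmoothConvexLoss L f) (hm : ∀ w, Measurable (f w))
    (hi : ∀ w, Integrable (f w) ρ) (hη : 0 < η) (hLη : L * η ≤ 1) (hT : 0 < T) (hu : u ∈ Ω)
    (hmin : ∀ w ∈ Ω, popRisk ρ f u ≤ popRisk ρ f w) :
    popRisk ρ f u - (T : ℝ)⁻¹ * (popRisk ρ f u + L * ‖u‖ ^ 2)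
      ≤ ∫ p, popRisk ρ f (sgdAverage Ω f (fun _ => η) p.1 p.2 T) ∂(sampleIndexLaw ρ n) := by
  have hsum : ∑ _t ∈ Finset.range T, η = T * η := by simp
  have hpos : 0 < ∑ _t ∈ Finset.range T, η :=
    Finset.sum_pos (fun _ _ => hη) ⟨0, Finset.mem_range.2 hT⟩
  have hle := hf.popRisk_sub_le_integral_popRisk_sgdAverage (n := n) (η := fun _ => η) hL hΩ hm hi
    (fun _ => hη.le) (fun _ => hLη) hpos hu hmin
  rwa [hsum, div_mul_cancel_right₀ hη.ne'] at hle

theorem integral_popRisk_sgdAverage_le_of_step_div_sqrt (hL : 0 < L) (hΩ : IsFeasibleSet Ω)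
    (hf : IsSmoothConvexLoss L f) (hm : ∀ w, Measurable (f w)) (hi : ∀ w, Integrable (f w) ρ)
    (hc : 0 < c) (ha : 0 < a) (haT : a * T ≤ n) (hbT : (n : ℝ) ≤ b * T)
    (hLc : L * (c / √T) ≤ 1 / 2) (hu : u ∈ Ω) (huR : ‖u‖ ≤ R) :
    ∫ p, popRisk ρ f (sgdAverage Ω f (fun _ => c / √T) p.1 p.2 T) ∂(sampleIndexLaw ρ n)
      ≤ popRisk ρ f u + (1 + (L + 12 * L * (L + 1) * (1 + 1 / a) * c ^ 2)) * (1 + 2 * L * c * √b)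
          * (1 + R ^ 2 * √b / (2 * c)) * (popRisk ρ f u + 1) * (√n)⁻¹ := by
  have hn : (1 : ℝ) ≤ √n := Real.one_le_sqrt.2 (Nat.one_le_cast.2 (Nat.pos_of_neZero n))
  have hT : (0 : ℝ) < T := Nat.cast_pos.2 (pos_of_natCast_le_mul hbT)
  have hsqrtT : (√(T : ℝ))⁻¹ ≤ √b * (√n)⁻¹ := inv_sqrt_natCast_le_div_sqrt_natCast hbT
  have hF := hf.popRisk_nonneg ρ u
  have hstability : 12 * L * (L + √n) / n * (T * (c / √T) ^ 2 * (1 + T / n))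
      ≤ 12 * L * (L + 1) * (1 + 1 / a) * c ^ 2 * (√n)⁻¹ :=
    stability_term_le_of_step_div_sqrt c hL.le ha haT (Nat.cast_pos.1 hT)
  have hstep : 2 * L * (c / √T) ≤ 2 * L * c * √b * (√n)⁻¹ := by
    rw [div_eq_mul_inv, ← mul_assoc, mul_assoc _ √b]
    gcongr
  have hinit : ‖u‖ ^ 2 / (2 * (T * (c / √T))) ≤ R ^ 2 * √b / (2 * c) * (√n)⁻¹ := by
    calc ‖u‖ ^ 2 / (2 * (T * (c / √T)))
      _ = ‖u‖ ^ 2 / (2 * c) * (√T)⁻¹ := by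
        nth_rw 1 [← Real.mul_self_sqrt hT.le]
        field
      _ ≤ R ^ 2 / (2 * c) * (√b * (√n)⁻¹) := by gcongr
      _ = R ^ 2 * √b / (2 * c) * (√n)⁻¹ := by ring
  calc ∫ p, popRisk ρ f (sgdAverage Ω f (fun _ => c / √T) p.1 p.2 T) ∂(sampleIndexLaw ρ n)
    _ ≤ (1 + L / √n + 12 * L * (L + √n) / n * (T * (c / √T) ^ 2 * (1 + T / n)))
        * ((1 + 2 * L * (c / √T)) * (popRisk ρ f u + ‖u‖ ^ 2 / (2 * (T * (c / √T))))) :=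
      hf.integral_popRisk_sgdAverage_le_of_const_step hL hΩ hm hi (by positivity) hLc
        (Nat.cast_pos.1 hT) (by positivity) hu
    _ ≤ (1 + (L + 12 * L * (L + 1) * (1 + 1 / a) * c ^ 2) * (√n)⁻¹)
        * ((1 + 2 * L * c * √b * (√n)⁻¹)
          * (popRisk ρ f u + R ^ 2 * √b / (2 * c) * (√n)⁻¹)) := by
      gcongr ?_ * ((1 + ?_) * (_ + ?_))
      linarith [div_eq_mul_inv L √n]
    _ ≤ _ := one_add_mul_mul_add_mul_le (by positivity) (by positivity) (by positivity) hF
      (by positivity) (inv_le_one_of_one_le₀ hn)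

theorem abs_integral_popRisk_sgdAverage_sub_le_of_step_div_sqrt (hL : 0 < L)
    (hΩ : IsFeasibleSet Ω) (hf : IsSmoothConvexLoss L f) (hm : ∀ w, Measurable (f w))
    (hi : ∀ w, Integrable (f w) ρ) (hc : 0 < c) (ha : 0 < a) (haT : a * T ≤ n)
    (hbT : (n : ℝ) ≤ b * T) (hLc : L * (c / √T) ≤ 1 / 2) (hu : u ∈ Ω)
    (hmin : ∀ w ∈ Ω, popRisk ρ f u ≤ popRisk ρ f w) (huR : ‖u‖ ≤ R) :
    |(∫ p, popRisk ρ f (sgdAverage Ω f (fun _ => c / √T) p.1 p.2 T) ∂(sampleIndexLaw ρ n))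
        - popRisk ρ f u| ≤ rateConstant L c R a b * ((popRisk ρ f u + 1) / √n) := by
  have hT := pos_of_natCast_le_mul hbT
  have hn : (1 : ℝ) ≤ √n := Real.one_le_sqrt.2 (Nat.one_le_cast.2 (Nat.pos_of_neZero n))
  have hF := hf.popRisk_nonneg ρ u
  have hb : 0 ≤ b := nonneg_of_natCast_le_mul hbT
  have hupper := hf.integral_popRisk_sgdAverage_le_of_step_div_sqrt hL hΩ hm hi hc ha haT hbT hLc
    hu huR
  have hlower := hf.popRisk_sub_le_integral_popRisk_sgdAverage_of_const_step (n := n) hL hΩ hm hi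
    (η := c / √T) (by positivity) (by linarith) hT hu hmin
  have hinit : (T : ℝ)⁻¹ * (popRisk ρ f u + L * ‖u‖ ^ 2)
      ≤ b * (1 + L * R ^ 2) * ((popRisk ρ f u + 1) / √n) := by
    calc (T : ℝ)⁻¹ * (popRisk ρ f u + L * ‖u‖ ^ 2)
      _ ≤ b / √n * (popRisk ρ f u + L * R ^ 2) := by
        gcongr
        refine (inv_natCast_le_div_natCast hbT).trans ?_
        gcongr
        exact Real.sqrt_le_iff.2 ⟨n.cast_nonneg,
          le_self_pow₀ (Nat.one_le_cast.2 (Nat.pos_of_neZero n)) two_ne_zero⟩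
      _ ≤ b / √n * ((1 + L * R ^ 2) * (popRisk ρ f u + 1)) := by
        gcongr
        linarith [show 0 ≤ 1 + L * R ^ 2 * popRisk ρ f u by positivity]
      _ = b * (1 + L * R ^ 2) * ((popRisk ρ f u + 1) / √n) := by ring
  have hpos : 0 ≤ b * (1 + L * R ^ 2) * ((popRisk ρ f u + 1) / √n) := by positivity
  have hpos' : 0 ≤ (1 + (L + 12 * L * (L + 1) * (1 + 1 / a) * c ^ 2)) * (1 + 2 * L * c * √b)
      * (1 + R ^ 2 * √b / (2 * c)) * ((popRisk ρ f u + 1) / √n) := by positivity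
  rw [rateConstant, add_mul, abs_le]
  constructor
  · linarith
  · rw [mul_assoc _ _ (√n)⁻¹, ← div_eq_mul_inv] at hupper
    linarith

theorem abs_integral_popRisk_sgdAverage_sub_le_of_popRisk_eq_zero {η : ℝ} (hL : 0 < L)
    (hΩ : IsFeasibleSet Ω) (hf : IsSmoothConvexLoss L f) (hm : ∀ w, Measurable (f w))
    (hi : ∀ w, Integrable (f w) ρ) (hη : 0 < η) (hLη : L * η ≤ 1 / 2) (ha : 0 < a)
    (haT : a * T ≤ n) (hbT : (n : ℝ) ≤ b * T) (hu : u ∈ Ω) (hu0 : popRisk ρ f u = 0)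
    (huR : ‖u‖ ≤ R) :
    |(∫ p, popRisk ρ f (sgdAverage Ω f (fun _ => η) p.1 p.2 T) ∂(sampleIndexLaw ρ n))
        - popRisk ρ f u| ≤ lowNoiseRateConstant L η R a b * (1 / n) := by
  have hT := pos_of_natCast_le_mul hbT
  have : (0 : ℝ) < T := Nat.cast_pos.2 hT
  have hratio := natCast_div_natCast_le_one_div ha haT
  have hstability : 12 * L * (L + 1) / n * (T * η ^ 2 * (1 + T / n))
      ≤ 12 * L * (L + 1) * (1 + 1 / a) * η ^ 2 / a := by
    calc 12 * L * (L + 1) / n * (T * η ^ 2 * (1 + T / n))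
      _ = 12 * L * (L + 1) * (1 + T / n) * η ^ 2 * (T / n) := by ring
      _ ≤ 12 * L * (L + 1) * (1 + 1 / a) * η ^ 2 * (1 / a) := by gcongr
      _ = 12 * L * (L + 1) * (1 + 1 / a) * η ^ 2 / a := mul_one_div _ _
  have hinit : ‖u‖ ^ 2 / (2 * (T * η)) ≤ R ^ 2 * b / (2 * η) * (1 / n) := by
    calc ‖u‖ ^ 2 / (2 * (T * η))
      _ = ‖u‖ ^ 2 / (2 * η) * (T : ℝ)⁻¹ := by field
      _ ≤ R ^ 2 / (2 * η) * (b / n) := by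
        gcongr
        exact inv_natCast_le_div_natCast hbT
      _ = R ^ 2 * b / (2 * η) * (1 / n) := by ring
  rw [hu0, sub_zero, abs_of_nonneg (integral_nonneg fun p => hf.popRisk_nonneg ρ _)]
  refine (hf.integral_popRisk_sgdAverage_le_of_const_step hL hΩ hm hi hη hLη hT one_pos
    hu).trans ?_
  have : 0 ≤ b := nonneg_of_natCast_le_mul hbT
  rw [hu0, zero_add, div_one, lowNoiseRateConstant, mul_assoc _ _ (1 / (n : ℝ)),
    mul_assoc _ _ (1 / (n : ℝ))]
  gcongr

end IsSmoothConvexLoss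

end Rates

theorem mainTheorem4 :
    -- (a) step sizes `c / √T`
    (∀ L c R a b : ℝ, 0 < L → 0 < c → 0 ≤ R → 0 < a → 0 < b →
      ∃ C : ℝ, ∀ (d : ℕ) (Z : Type*) [MeasurableSpace Z] (ρ : Measure Z) [IsProbabilityMeasure ρ]
        (Ω : Set (Param d)) (f : Param d → Z → ℝ) (wstar : Param d) (n T : ℕ) [NeZero n],
        IsClosed Ω → Convex ℝ Ω →
        (∀ w, Measurable (f w)) → (∀ w, Integrable (f w) ρ) →
        IsSmoothConvexLoss L f →
        wstar ∈ Ω → (∀ w ∈ Ω, popRisk ρ f wstar ≤ popRisk ρ f w) → ‖wstar‖ ≤ R →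
        a * (T : ℝ) ≤ n → (n : ℝ) ≤ b * T →
        c / √(T : ℝ) ≤ 1 / (2 * L) →
        Integrable
          (fun p => popRisk ρ f (sgdAverage Ω f (fun _ => c / √(T : ℝ)) p.1 p.2 T))
          (sampleIndexLaw ρ n) ∧
        |(∫ p, popRisk ρ f (sgdAverage Ω f (fun _ => c / √(T : ℝ)) p.1 p.2 T)
            ∂(sampleIndexLaw ρ n)) - popRisk ρ f wstar|
          ≤ C * ((popRisk ρ f wstar + 1) / √(n : ℝ))) ∧
    -- (b) constant step size in the low-noise case
    (∀ L η₁ R a b : ℝ, 0 < L → 0 < η₁ → η₁ ≤ 1 / (2 * L) → 0 ≤ R → 0 < a → 0 < b →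
      ∃ C : ℝ, ∀ (d : ℕ) (Z : Type*) [MeasurableSpace Z] (ρ : Measure Z) [IsProbabilityMeasure ρ]
        (Ω : Set (Param d)) (f : Param d → Z → ℝ) (wstar : Param d) (n T : ℕ) [NeZero n],
        IsClosed Ω → Convex ℝ Ω →
        (∀ w, Measurable (f w)) → (∀ w, Integrable (f w) ρ) →
        IsSmoothConvexLoss L f →
        wstar ∈ Ω → (∀ w ∈ Ω, popRisk ρ f wstar ≤ popRisk ρ f w) → ‖wstar‖ ≤ R →
        popRisk ρ f wstar = 0 →
        a * (T : ℝ) ≤ n → (n : ℝ) ≤ b * T →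
        Integrable
          (fun p => popRisk ρ f (sgdAverage Ω f (fun _ => η₁) p.1 p.2 T))
          (sampleIndexLaw ρ n) ∧
        |(∫ p, popRisk ρ f (sgdAverage Ω f (fun _ => η₁) p.1 p.2 T)
            ∂(sampleIndexLaw ρ n)) - popRisk ρ f wstar|
          ≤ C * (1 / (n : ℝ))) := by
  have hstep {L η : ℝ} (hL : 0 < L) (hη : η ≤ 1 / (2 * L)) : L * η ≤ 1 / 2 := by
    rw [le_div_iff₀ (by positivity)] at hη
    linarith
  refine ⟨fun L c R a b hL hc _ ha _ => ⟨rateConstant L c R a b, ?_⟩,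
    fun L η R a b hL hη hηL _ ha _ => ⟨lowNoiseRateConstant L η R a b, ?_⟩⟩
  · intro d Z _ ρ _ Ω f wstar n T _ hcl hcv hm hi hf hw hmin hR haT hbT hcL
    have hΩ : IsFeasibleSet Ω := ⟨⟨wstar, hw⟩, hcl, hcv⟩
    have hLc := hstep hL hcL
    have hT : 0 < T := pos_of_natCast_le_mul hbT
    exact ⟨hf.integrable_popRisk_sgdAverage_of_const_step hL hΩ hm hi (by positivity)
        (by linarith) hT,
      hf.abs_integral_popRisk_sgdAverage_sub_le_of_step_div_sqrt hL hΩ hm hi hc ha haT hbT hLc hw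
        hmin hR⟩
  · intro d Z _ ρ _ Ω f wstar n T _ hcl hcv hm hi hf hw _ hR hF haT hbT
    have hΩ : IsFeasibleSet Ω := ⟨⟨wstar, hw⟩, hcl, hcv⟩
    have hLη := hstep hL hηL
    have hT : 0 < T := pos_of_natCast_le_mul hbT
    exact ⟨hf.integrable_popRisk_sgdAverage_of_const_step hL hΩ hm hi hη (by linarith) hT,
      hf.abs_integral_popRisk_sgdAverage_sub_le_of_popRisk_eq_zero hL hΩ hm hi hη hLη ha haT hbT hw
        hF hR⟩
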